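/- Let $G$ be a finite simple graph that is maximal planar, i.e. $G$ is planar and no planar graph on the same vertex set properly contains $G$. Fix any plane embedding of $G$. A split of a vertex $v$ with respect to two different faces $f_1,f_2$ that have a corner at $v$ replaces $v$ by two vertices $v_1,v_2$: cutting the cyclic order of the edges at $v$ at the two corners gives two intervals, one of which becomes the cyclic order of edges at $v_1$ and the other the one at $v_2$; the rest of the embedding is unchanged, so that $f_1$ and $f_2$ are merged into one face. Splits may be applied successively, also to copies of vertices. The outerplane splitting number $\operatorname{osn}(G)$ is the minimum number of such splits that transform $G$ into an outerplane graph, that is, a plane graph with a face whose boundary contains all vertices. A connected face cover of $G$ is a set $S$ of faces such that every vertex lies on the boundary of a face in $S$ and the subgraph induced by $V(G)\cup S$ in the vertex-face incidence graph is connected. Then: 1. $\operatorname{osn}(G)\ \ge\ \dfrac{|V(G)|-3}{2}$. 2. For every connected face cover $S$ of $G$ and every $f\in S$, the faces in $S$ can be listed without repetition as $f=g_0,g_1,\dots,g_m$ so that, for each $i\ge 1$, at most two vertices lie on the boundary of $g_i$ but on the boundary of none of $g_0,\dots,g_{i-1}$. -/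

import Mathlib

universe u w

/-- A graph with vertex set `V`, embedded in an oriented surface, given combinatorially.
Each edge consists of two opposite darts (half-edges) exchanged by `rev`; `tail d` is the vertex at
which the dart `d` starts; `rot` sends a dart to the next one in the cyclic order of the darts
around its tail, so the cycles of `rot` are exactly the sets of darts at the nonisolated
vertices. -/
structure EmbeddedGraph (V : Type u) (D : Type w) where
  tail : D → V
  rev : Equiv.Perm D
  rot : Equiv.Perm D
  rev_rev : ∀ d, rev (rev d) = d
  rev_ne : ∀ d, rev d ≠ d
  sameCycle_rot_iff : ∀ d e, rot.SameCycle d e ↔ tail d = tail e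

namespace EmbeddedGraph

variable {V : Type u} {D : Type w}

/-- One step along the boundary of a face: traverse `d`, then leave its head along the dart that
follows `rev d` in the cyclic order. The cycle of `d` is the face that has, at the vertex `tail d`,
the corner between `rot⁻¹ d` and `d`. -/
def facePerm (M : EmbeddedGraph V D) : Equiv.Perm D := M.rot * M.rev

/-- The underlying simple graph. -/
def graph (M : EmbeddedGraph V D) : SimpleGraph V :=
  SimpleGraph.fromRel fun x y => ∃ d, M.tail d = x ∧ M.tail (M.rev d) = y

/-- The faces: one for each facial walk, and one for each isolated vertex. (For a connected graph
with at least one vertex these are the faces of the embedding; in general they are the faces of its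
connected components, each component being embedded in a surface of its own.) -/
def Face (M : EmbeddedGraph V D) : Type (max u w) :=
  Quotient (Equiv.Perm.SameCycle.setoid M.facePerm) ⊕ {v : V // ∀ d, M.tail d ≠ v}

/-- The vertex `v` lies on the boundary of the face. -/
def Incident (M : EmbeddedGraph V D) (v : V) : M.Face → Prop
  | Sum.inl f => ∃ d, M.tail d = v ∧ Quotient.mk _ d = f
  | Sum.inr x => x.1 = v

/-- The vertices on the boundary of a face. -/
def boundary (M : EmbeddedGraph V D) (f : M.Face) : Set V := {v | M.Incident v f}

/-- The embedding has genus zero, that is, it is an embedding in the plane (sphere): Euler's formula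
`|V| - |E| + |F| = 2 c` holds, with `c` connected components, where `|E|` is half the number of
darts and faces are counted for each component separately. -/
def IsPlane (M : EmbeddedGraph V D) : Prop :=
  2 * (Nat.card V + Nat.card M.Face) = Nat.card D + 4 * Nat.card M.graph.ConnectedComponent

/-- The embedding is outerplane: it is plane and all vertices lie on the boundary of one face. -/
def IsOuterplane (M : EmbeddedGraph V D) : Prop :=
  M.IsPlane ∧ ∃ f : M.Face, ∀ v, M.Incident v f

open Classical in
/-- The cyclic orders after a vertex with darts `a` and `b` has been split: the cyclic order
`a, …, rot⁻¹ b, b, …, rot⁻¹ a` is cut into the two cyclic orders `a, …, rot⁻¹ b` and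
`b, …, rot⁻¹ a`. -/
noncomputable def splitRot (M : EmbeddedGraph V D) (a b : D) : Equiv.Perm D :=
  Equiv.swap a b * M.rot

open Classical in
/-- The tails after the split: the darts `b, …, rot⁻¹ a` are moved to a new vertex `none`. -/
noncomputable def splitTail (M : EmbeddedGraph V D) (a b : D) (d : D) : Option V :=
  if (M.splitRot a b).SameCycle b d then none else some (M.tail d)

theorem tail_rot (M : EmbeddedGraph V D) (d : D) : M.tail (M.rot d) = M.tail d :=
  ((M.sameCycle_rot_iff _ _).1 ⟨1, by simp⟩).symm

theorem tail_splitRot (M : EmbeddedGraph V D) {a b : D} (h : M.tail a = M.tail b) (d : D) :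
    M.tail (M.splitRot a b d) = M.tail d := by
  classical
  rw [← M.tail_rot d]
  simp only [splitRot, Equiv.Perm.mul_apply, Equiv.swap_apply_def]
  split_ifs with h1 h2
  · rw [h1, h]
  · rw [h2, h]
  · rfl

theorem tail_eq_of_sameCycle_splitRot (M : EmbeddedGraph V D) {a b : D}
    (h : M.tail a = M.tail b) {d e : D} (hde : (M.splitRot a b).SameCycle d e) :
    M.tail d = M.tail e := by
  obtain ⟨i, rfl⟩ := hde
  induction i using Int.induction_on with
  | zero => simp
  | succ n ih =>
    rw [add_comm, zpow_add, zpow_one, Equiv.Perm.mul_apply, M.tail_splitRot h, ← ih]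
  | pred n ih =>
    rw [ih, ← M.tail_splitRot h (((M.splitRot a b) ^ (-(n : ℤ) - 1)) d),
      ← Equiv.Perm.mul_apply, ← zpow_one_add]
    congr 3
    ring

theorem sameCycle_splitRot (M : EmbeddedGraph V D) (a b : D) {d e : D}
    (hde : M.rot.SameCycle d e) :
    (M.splitRot a b).SameCycle d e ∨
      (((M.splitRot a b).SameCycle a d ∨ (M.splitRot a b).SameCycle b d) ∧
        ((M.splitRot a b).SameCycle a e ∨ (M.splitRot a b).SameCycle b e)) := by
  classical
  set s := M.splitRot a b with hs
  have step : ∀ x, s.SameCycle x (M.rot x) ∨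
      ((s.SameCycle a x ∨ s.SameCycle b x) ∧
        (s.SameCycle a (M.rot x) ∨ s.SameCycle b (M.rot x))) := by
    intro x
    have hx : s.SameCycle x (s x) := ⟨1, by simp⟩
    have hsx : s x = Equiv.swap a b (M.rot x) := rfl
    by_cases h1 : M.rot x = a
    · rw [hsx, h1, Equiv.swap_apply_left] at hx
      exact Or.inr ⟨Or.inr hx.symm, Or.inl (by rw [h1])⟩
    · by_cases h2 : M.rot x = b
      · rw [hsx, h2, Equiv.swap_apply_right] at hx
        exact Or.inr ⟨Or.inl hx.symm, Or.inr (by rw [h2])⟩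
      · rw [hsx, Equiv.swap_apply_of_ne_of_ne h1 h2] at hx
        exact Or.inl hx
  have tr : ∀ x y z : D, s.SameCycle x y → s.SameCycle y z → s.SameCycle x z :=
    fun _ _ _ p q => p.trans q
  have sy : ∀ x y : D, s.SameCycle x y → s.SameCycle y x := fun _ _ p => p.symm
  obtain ⟨i, rfl⟩ := hde
  induction i using Int.induction_on with
  | zero => exact Or.inl (by simpa using Equiv.Perm.SameCycle.refl s d)
  | succ n ih =>
    have h := step ((M.rot ^ (n : ℤ)) d)
    rw [add_comm, zpow_add, zpow_one, Equiv.Perm.mul_apply]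
    grind
  | pred n ih =>
    have h := step ((M.rot ^ (-(n : ℤ) - 1)) d)
    rw [← Equiv.Perm.mul_apply, ← zpow_one_add, show (1 : ℤ) + (-(n : ℤ) - 1) = -n by ring] at h
    grind

/-- The embedding-preserving split of the vertex `v = tail a = tail b` at the corners in front of
`a` and `b`. Of the two copies of `v`, one is called `some v` and keeps the darts `a, …, rot⁻¹ b`,
the other one is called `none` and gets the darts `b, …, rot⁻¹ a`. -/
noncomputable def split (M : EmbeddedGraph V D) (a b : D) (h : M.tail a = M.tail b) :
    EmbeddedGraph (Option V) D where
  tail := M.splitTail a b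
  rev := M.rev
  rot := M.splitRot a b
  rev_rev := M.rev_rev
  rev_ne := M.rev_ne
  sameCycle_rot_iff d e := by
    constructor
    · intro hde
      have h1 := M.tail_eq_of_sameCycle_splitRot h hde
      have h2 : (M.splitRot a b).SameCycle b d ↔ (M.splitRot a b).SameCycle b e :=
        ⟨fun p => p.trans hde, fun p => p.trans hde.symm⟩
      by_cases hb : (M.splitRot a b).SameCycle b e
      · rw [splitTail, splitTail, if_pos (h2.2 hb), if_pos hb]
      · rw [splitTail, splitTail, if_neg (fun p => hb (h2.1 p)), if_neg hb, h1]
    · intro hde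
      by_cases hd : (M.splitRot a b).SameCycle b d <;>
        by_cases he : (M.splitRot a b).SameCycle b e
      · exact hd.symm.trans he
      · simp [splitTail, hd, he] at hde
      · simp [splitTail, hd, he] at hde
      · simp only [splitTail, hd, he, if_false, Option.some.injEq] at hde
        rcases M.sameCycle_splitRot a b ((M.sameCycle_rot_iff d e).2 hde) with h1 | ⟨h1, h2⟩
        · exact h1
        · exact (h1.resolve_right hd).symm.trans (h2.resolve_right he)

/-- `M` can be made outerplane by `k` successive splits, each of which splits a vertex with respect
to two different faces (those with the corners in front of `a` and `b`), merging them. -/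
def SplitsToOuterplane : ℕ → ∀ {V : Type u}, EmbeddedGraph V D → Prop
  | 0, _, M => M.IsOuterplane
  | k + 1, _, M => ∃ (a b : D) (h : M.tail a = M.tail b),
      ¬ M.facePerm.SameCycle a b ∧ SplitsToOuterplane k (M.split a b h)

/-- The outerplane splitting number: the least number of splits that make `M` outerplane. -/
noncomputable def osn (M : EmbeddedGraph V D) : ℕ := sInf {k | SplitsToOuterplane k M}

/-- The face-vertex incidence graph. -/
def faceVertexGraph (M : EmbeddedGraph V D) : SimpleGraph (V ⊕ M.Face) :=
  SimpleGraph.fromRel fun x y => ∃ v f, x = Sum.inl v ∧ y = Sum.inr f ∧ M.Incident v f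

/-- A connected face cover: each vertex is on the boundary of a face in `S`, and the subgraph of the
face-vertex incidence graph that is induced by all vertices and the faces in `S` is connected. -/
def IsConnectedFaceCover (M : EmbeddedGraph V D) (S : Set M.Face) : Prop :=
  (∀ v, ∃ f ∈ S, M.Incident v f) ∧
    (M.faceVertexGraph.induce {x | ∀ f, x = Sum.inr f → f ∈ S}).Connected

end EmbeddedGraph

/-- A rotation system of a simple graph: a cyclic order of the darts around each vertex. -/
structure RotationSystem {V : Type u} (G : SimpleGraph V) where
  rot : Equiv.Perm G.Dart
  sameCycle_rot_iff : ∀ d e : G.Dart, rot.SameCycle d e ↔ d.fst = e.fst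

/-- The embedding of `G` that a rotation system describes. -/
def RotationSystem.embedding {V : Type u} {G : SimpleGraph V} (R : RotationSystem G) :
    EmbeddedGraph V G.Dart where
  tail d := d.fst
  rev := SimpleGraph.Dart.symm_involutive.toPerm
  rot := R.rot
  rev_rev d := d.symm_symm
  rev_ne d := d.symm_ne
  sameCycle_rot_iff := R.sameCycle_rot_iff

/-- A simple graph is planar if it has a plane embedding. -/
def IsPlanar {V : Type u} (G : SimpleGraph V) : Prop :=
  ∃ R : RotationSystem G, R.embedding.IsPlane

/-- A graph is maximal planar if it is planar and no edges can be added to it (on the same vertex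
set) so that it stays planar. -/
def IsMaximalPlanar {V : Type u} (G : SimpleGraph V) : Prop := Maximal IsPlanar G

/-! Both claims rest on one fact: with at least three vertices, every face of a maximal planar graph
is a triangle, that is, `facePerm` has third power one (`IsMaximalPlanar.facePerm_pow_three`). With
fewer vertices both claims are immediate.

Euler counting shows that an edge between two components, or between two corners of one face of a
connected graph, can be added without leaving the plane. By maximality the graph is connected and
cofacial vertices are adjacent. If a face had consecutive vertices v0, v1, v2, v3 with v3 ≠ v0, both
edges v0v2 and v1v3 would exist and would have to cross outside the face. The crossing is excluded
by a discrete Jordan theorem (`IsPlane.exists_separation`): by Euler's formula, every mod 2 cycle in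
a connected plane graph is the boundary of a set of faces.

For the first claim, a split multiplies both `rot` and `facePerm` by one transposition. Traced back
through k splits, the final outer face consists of at most k + 1 original faces. It has a dart at
each of the |V| + k final vertices, so |V| + k ≤ 3(k + 1). Such splits exist, since each one lowers
the number of faces.

For the second claim, connectedness allows the faces to be listed so that each shares a vertex with
an earlier one; at most two of its three vertices are then new. -/

theorem Nat.card_quotient_merge {α : Type*} [Finite α] (r r' : Setoid α) {a b : α}
    (hab : ¬ r a b)
    (h : ∀ x y, r' x y ↔ r x y ∨ ((r a x ∨ r b x) ∧ (r a y ∨ r b y))) :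
    Nat.card (Quotient r') + 1 = Nat.card (Quotient r) := by
  classical
  have hle : ∀ x y, r x y → r' x y := fun x y hxy => (h x y).2 (Or.inl hxy)
  let π : Quotient r → Quotient r' := Quotient.map id hle
  -- The coarser quotient is the finer one without the class of `b`, which is absorbed by the class
  -- of `a`.
  have hbij : Function.Bijective
      (fun q : {q : Quotient r // q ≠ Quotient.mk r b} => π q.1) := by
    constructor
    · rintro ⟨q₁, h₁⟩ ⟨q₂, h₂⟩ hq
      induction q₁ using Quotient.inductionOn with | _ x
      induction q₂ using Quotient.inductionOn with | _ y
      have hx : ¬ r b x := fun e => h₁ (Quotient.sound e).symm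
      have hy : ¬ r b y := fun e => h₂ (Quotient.sound e).symm
      have hxy : r' x y := Quotient.exact hq
      refine Subtype.ext (Quotient.sound ?_)
      rcases (h x y).1 hxy with e | ⟨e₁, e₂⟩
      · exact e
      · exact r.trans (r.symm (e₁.resolve_right hx)) (e₂.resolve_right hy)
    · intro q
      induction q using Quotient.inductionOn with | _ x
      by_cases hx : r b x
      · refine ⟨⟨Quotient.mk r a, fun e => hab (Quotient.exact e)⟩, ?_⟩
        exact Quotient.sound ((h _ _).2 (Or.inr ⟨Or.inl (r.refl a), Or.inr hx⟩))
      · exact ⟨⟨Quotient.mk r x, fun e => hx (r.symm (Quotient.exact e))⟩, rfl⟩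
  have := Fintype.ofFinite (Quotient r)
  rw [← Nat.card_congr (Equiv.ofBijective _ hbij), Nat.card_eq_fintype_card,
    Nat.card_eq_fintype_card, Fintype.card_subtype_compl, Fintype.card_subtype_eq]
  have : 0 < Fintype.card (Quotient r) := Fintype.card_pos_iff.2 ⟨Quotient.mk r b⟩
  omega

/-! ### Cycles of a permutation multiplied by a transposition -/

namespace Equiv.Perm

variable {α : Type*}

theorem SameCycle.map_eq {β : Type*} {σ : Perm α} {f : α → β} (hf : ∀ x, f (σ x) = f x)
    {x y : α} (h : σ.SameCycle x y) : f x = f y := by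
  obtain ⟨i, rfl⟩ := h
  induction i using Int.induction_on with
  | zero => simp
  | succ n ih => rw [add_comm, zpow_add, zpow_one, mul_apply, hf, ← ih]
  | pred n ih =>
    rw [ih, ← hf ((σ ^ (-(n : ℤ) - 1)) x), ← mul_apply, ← zpow_one_add]
    congr 3
    ring

theorem sameCycle_iff_of_map {β : Type*} (σ : Perm α) (f : α ≃ β) (τ : Perm β)
    (h : ∀ x, f (σ x) = τ (f x)) (x y : α) : τ.SameCycle (f x) (f y) ↔ σ.SameCycle x y := by
  have : τ = f.symm.trans (σ.trans f) := by
    ext z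
    simp [h]
  have hpow : ∀ i : ℕ, ∀ z, (τ ^ i) (f z) = f ((σ ^ i) z) := by
    intro i
    induction i with
    | zero => simp
    | succ n ih => intro z; rw [pow_succ, mul_apply, pow_succ, mul_apply, ← h, ih]
  have hz : ∀ i : ℤ, ∀ z, (τ ^ i) (f z) = f ((σ ^ i) z) := by
    intro i z
    obtain ⟨n, rfl | rfl⟩ := i.eq_nat_or_neg
    · simpa using hpow n z
    · rw [zpow_neg, zpow_neg, zpow_natCast, zpow_natCast, inv_eq_iff_eq, hpow]
      simp
  simp [SameCycle, hz]

/-- A step of the product is a step of `σ`, possibly followed by a jump between `a` and `b`, so the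
right-hand side is invariant along it. Nothing is assumed about `a` and `b`, so the lemma serves for
merging and for cutting. -/
theorem SameCycle.of_swap_mul [DecidableEq α] {σ : Perm α} {a b d e : α}
    (h : (swap a b * σ).SameCycle d e) :
    σ.SameCycle d e ∨
      ((σ.SameCycle a d ∨ σ.SameCycle b d) ∧ (σ.SameCycle a e ∨ σ.SameCycle b e)) := by
  have key : ∀ x, (σ.SameCycle d ((swap a b * σ) x) ∨ ((σ.SameCycle a d ∨ σ.SameCycle b d) ∧
      (σ.SameCycle a ((swap a b * σ) x) ∨ σ.SameCycle b ((swap a b * σ) x)))) =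
      (σ.SameCycle d x ∨ ((σ.SameCycle a d ∨ σ.SameCycle b d) ∧
      (σ.SameCycle a x ∨ σ.SameCycle b x))) := by
    intro x
    have hx : ∀ z, σ.SameCycle z x ↔ σ.SameCycle z (σ x) := fun z => sameCycle_apply_right.symm
    rw [mul_apply, hx, hx, hx, swap_apply_def]
    have hd := fun x => sameCycle_comm (f := σ) (x := d) (y := x)
    have ra := SameCycle.refl σ a
    have rb := SameCycle.refl σ b
    split_ifs with h1 h2
    · rw [h1, hd, hd]; simp only [eq_iff_iff]; tauto
    · rw [h2, hd, hd]; simp only [eq_iff_iff]; tauto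
    · rfl
  have := h.map_eq (f := fun x => σ.SameCycle d x ∨ ((σ.SameCycle a d ∨ σ.SameCycle b d) ∧
      (σ.SameCycle a x ∨ σ.SameCycle b x))) key
  rw [← this]
  exact Or.inl (SameCycle.refl σ d)

/-- From `a` the product runs through the whole `σ`-cycle of `a`; the step that would close it is
redirected to `b`. -/
theorem sameCycle_swap_mul [Finite α] [DecidableEq α] {σ : Perm α} {a b : α}
    (h : ¬ σ.SameCycle a b) : (swap a b * σ).SameCycle a b := by
  have key : ∀ i : ℕ, (swap a b * σ).SameCycle a ((σ ^ i) a) := by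
    intro i
    induction i with
    | zero => exact SameCycle.refl _ a
    | succ n ih =>
      rw [← sameCycle_apply_right] at ih
      rw [pow_succ', mul_apply]
      rw [mul_apply, swap_apply_def] at ih
      split_ifs at ih with h1 h2
      · rw [h1]
      · exact absurd ⟨n + 1, by rw [← h2]; norm_cast; rw [pow_succ', mul_apply]⟩ h
      · exact ih
  obtain ⟨i, hi⟩ := ((sameCycle_symm_apply_right (f := σ)).2 (SameCycle.refl σ a)).exists_nat_pow_eq
  have := sameCycle_apply_right.2 (key i)
  rwa [hi, mul_apply, apply_symm_apply, swap_apply_left] at this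

/-- With `k` the first time at which `σ` takes `a` to `b`, the product returns to `a` instead of
reaching `b`, so its orbit of `a` stays among the first `k` iterates. -/
theorem not_sameCycle_swap_mul [Finite α] [DecidableEq α] {σ : Perm α} {a b : α} (hab : a ≠ b)
    (h : σ.SameCycle a b) : ¬ (swap a b * σ).SameCycle a b := by
  have hex : ∃ k : ℕ, (σ ^ k) a = b := h.exists_nat_pow_eq
  classical
  set k := Nat.find hex with hk
  have hkb : (σ ^ k) a = b := Nat.find_spec hex
  have hmin : ∀ j < k, (σ ^ j) a ≠ b := fun j hj => Nat.find_min hex hj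
  have hk0 : 0 < k := by
    rcases Nat.eq_zero_or_pos k with h0 | h0
    · rw [h0] at hkb; exact absurd hkb hab
    · exact h0
  have hret : ∀ j, 0 < j → j < k → (σ ^ j) a ≠ a := by
    intro j hj hjk e
    apply hmin (k - j) (by omega)
    rw [← hkb]
    conv_rhs => rw [show k = (k - j) + j by omega, pow_add, mul_apply, e]
  have hinv : ∀ n : ℕ, ∃ i < k, ((swap a b * σ) ^ n) a = (σ ^ i) a := by
    intro n
    induction n with
    | zero => exact ⟨0, hk0, rfl⟩
    | succ n ih =>
      obtain ⟨i, hi, e⟩ := ih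
      rw [pow_succ', mul_apply, e, mul_apply, ← mul_apply σ, ← pow_succ']
      rcases Nat.lt_or_ge (i + 1) k with h1 | h1
      · exact ⟨i + 1, h1, swap_apply_of_ne_of_ne (hret _ (by omega) h1) (hmin _ h1)⟩
      · refine ⟨0, hk0, ?_⟩
        rw [show i + 1 = k by omega, hkb]
        simp
  intro hc
  obtain ⟨n, hn⟩ := hc.exists_nat_pow_eq
  obtain ⟨i, hi, e⟩ := hinv n
  exact hmin i hi (e ▸ hn)

theorem sameCycle_swap_mul_iff [Finite α] [DecidableEq α] {σ : Perm α} {a b : α}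
    (h : ¬ σ.SameCycle a b) (d e : α) :
    (swap a b * σ).SameCycle d e ↔ σ.SameCycle d e ∨
      ((σ.SameCycle a d ∨ σ.SameCycle b d) ∧ (σ.SameCycle a e ∨ σ.SameCycle b e)) := by
  refine ⟨SameCycle.of_swap_mul, fun hde => ?_⟩
  have hab := sameCycle_swap_mul h
  have back : ∀ {x y}, σ.SameCycle x y → (swap a b * σ).SameCycle x y := by
    intro x y hxy
    -- The swap is an involution, so `σ` is itself the swap times the product and `of_swap_mul`
    -- applies in reverse.
    rw [← swap_mul_self_mul a b σ] at hxy
    rcases hxy.of_swap_mul with e | ⟨e₁ | e₁, e₂ | e₂⟩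
    · exact e
    · exact e₁.symm.trans e₂
    · exact e₁.symm.trans (hab.trans e₂)
    · exact e₁.symm.trans (hab.symm.trans e₂)
    · exact e₁.symm.trans e₂
  rcases hde with e | ⟨e₁ | e₁, e₂ | e₂⟩
  · exact back e
  · exact (back e₁).symm.trans (back e₂)
  · exact (back e₁).symm.trans (hab.trans (back e₂))
  · exact (back e₁).symm.trans (hab.symm.trans (back e₂))
  · exact (back e₁).symm.trans (back e₂)

/-- The number of cycles of a permutation, fixed points included. -/
noncomputable def cycleCount (σ : Perm α) : ℕ := Nat.card (Quotient (SameCycle.setoid σ))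

theorem cycleCount_swap_mul_add_one [Finite α] [DecidableEq α] {σ : Perm α} {a b : α}
    (h : ¬ σ.SameCycle a b) : (swap a b * σ).cycleCount + 1 = σ.cycleCount :=
  Nat.card_quotient_merge _ _ h (sameCycle_swap_mul_iff h)

theorem cycleCount_swap_mul [Finite α] [DecidableEq α] {σ : Perm α} {a b : α} (hab : a ≠ b)
    (h : σ.SameCycle a b) : (swap a b * σ).cycleCount = σ.cycleCount + 1 := by
  rw [← cycleCount_swap_mul_add_one (not_sameCycle_swap_mul hab h), swap_mul_self_mul]

theorem sameCycle_sumCongr_inl {β : Type*} (σ : Perm α) (τ : Perm β) (x y : α) :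
    SameCycle (Equiv.sumCongr σ τ) (Sum.inl x) (Sum.inl y) ↔ σ.SameCycle x y := by
  have key : ∀ i : ℤ, ∀ z, ((Equiv.sumCongr σ τ : Perm (α ⊕ β)) ^ i) (Sum.inl z)
      = Sum.inl ((σ ^ i) z) := by
    intro i z
    have : (Equiv.sumCongr σ τ : Perm (α ⊕ β)) = sumCongrHom α β (σ, τ) := rfl
    rw [this, ← map_zpow]
    rfl
  simp [SameCycle, key]

theorem sameCycle_sumCongr_inr {β : Type*} (σ : Perm α) (τ : Perm β) (x y : β) :
    SameCycle (Equiv.sumCongr σ τ) (Sum.inr x) (Sum.inr y) ↔ τ.SameCycle x y := by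
  have key : ∀ i : ℤ, ∀ z, ((Equiv.sumCongr σ τ : Perm (α ⊕ β)) ^ i) (Sum.inr z)
      = Sum.inr ((τ ^ i) z) := by
    intro i z
    have : (Equiv.sumCongr σ τ : Perm (α ⊕ β)) = sumCongrHom α β (σ, τ) := rfl
    rw [this, ← map_zpow]
    rfl
  simp [SameCycle, key]

theorem not_sameCycle_sumCongr_inl_inr {β : Type*} (σ : Perm α) (τ : Perm β) (x : α) (y : β) :
    ¬ SameCycle (Equiv.sumCongr σ τ) (Sum.inl x) (Sum.inr y) := by
  intro h
  have := h.map_eq (f := Sum.isLeft) (by rintro (z | z) <;> rfl)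
  simp at this

theorem cycleCount_sumCongr {β : Type*} [Finite α] [Finite β] (σ : Perm α) (τ : Perm β) :
    cycleCount (Equiv.sumCongr σ τ) = σ.cycleCount + τ.cycleCount := by
  rw [cycleCount, cycleCount, cycleCount, ← Nat.card_sum]
  refine Nat.card_congr (Equiv.ofBijective
    (Quotient.lift (fun z : α ⊕ β => (Sum.map (Quotient.mk _) (Quotient.mk _) z :
      Quotient (SameCycle.setoid σ) ⊕ Quotient (SameCycle.setoid τ))) ?_) ⟨?_, ?_⟩)
  · rintro (x | x) (y | y) h
    · exact congrArg Sum.inl (Quotient.sound ((sameCycle_sumCongr_inl σ τ x y).1 h))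
    · exact absurd h (not_sameCycle_sumCongr_inl_inr σ τ x y)
    · exact absurd (SameCycle.symm h) (not_sameCycle_sumCongr_inl_inr σ τ y x)
    · exact congrArg Sum.inr (Quotient.sound ((sameCycle_sumCongr_inr σ τ x y).1 h))
  · intro p q
    induction p using Quotient.inductionOn with | _ x
    induction q using Quotient.inductionOn with | _ y
    rcases x with x | x <;> rcases y with y | y <;> intro h
    · exact Quotient.sound ((sameCycle_sumCongr_inl σ τ x y).2
        (Quotient.exact (Sum.inl_injective h)))
    · simp at h
    · simp at h
    · exact Quotient.sound ((sameCycle_sumCongr_inr σ τ x y).2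
        (Quotient.exact (Sum.inr_injective h)))
  · rintro (p | p) <;> induction p using Quotient.inductionOn with | _ x
    · exact ⟨Quotient.mk _ (Sum.inl x), rfl⟩
    · exact ⟨Quotient.mk _ (Sum.inr x), rfl⟩

end Equiv.Perm

/-! ### Attaching a fixed point or another cycle to a cycle -/

namespace Equiv.Perm

variable {α β : Type*} [DecidableEq α]

/-- Insert the fixed point `p` into the cycle of the element of `o`, if there is one. -/
def attach (σ : Perm α) (o : Option α) (p : α) : Perm α :=
  o.elim 1 (fun a => swap a p) * σ

/-- Cycles are the fibres of a labelling, and attaching merges the fibre of `p` into that of `v`.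
For `o = none` the label `v` is unused and only a renaming happens: this is a new edge ending at an
isolated vertex. -/
theorem sameCycle_attach [Finite α] [DecidableEq β] {σ : Perm α} {t : α → β}
    (hσ : ∀ d e, σ.SameCycle d e ↔ t d = t e) {o : Option α} {p : α} {v : β}
    (ho : (∀ a ∈ o, t a = v) ∧ (o = none → ∀ d, t d ≠ v)) (hp : t p ≠ v) (d e : α) :
    (σ.attach o p).SameCycle d e ↔
      (if t d = t p then v else t d) = (if t e = t p then v else t e) := by
  cases o with
  | none =>
    have h := ho.2 rfl
    have hd := h d
    have he := h e
    simp only [attach, Option.elim, one_mul, hσ]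
    grind
  | some a =>
    have h := ho.1 a rfl
    simp only [attach, Option.elim]
    rw [sameCycle_swap_mul_iff (by rw [hσ, h]; exact hp.symm)]
    simp only [hσ]
    grind

theorem cycleCount_attach [Finite α] {σ : Perm α} {o : Option α} {p : α}
    (h : ∀ a ∈ o, ¬ σ.SameCycle a p) :
    (σ.attach o p).cycleCount + (if o = none then 0 else 1) = σ.cycleCount := by
  cases o with
  | none => simp [attach]
  | some a => simpa [attach] using cycleCount_swap_mul_add_one (h a rfl)

end Equiv.Perm

/-! ### Connected components after adding an edge -/

namespace SimpleGraph

variable {V : Type*}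

theorem reachable_sup_edge_iff (G : SimpleGraph V) {x y : V} (hxy : x ≠ y) (u v : V) :
    (G ⊔ edge x y).Reachable u v ↔ G.Reachable u v ∨
      ((G.Reachable x u ∨ G.Reachable y u) ∧ (G.Reachable x v ∨ G.Reachable y v)) := by
  have hle : ∀ {u v}, G.Reachable u v → (G ⊔ edge x y).Reachable u v :=
    fun h => h.mono le_sup_left
  have hadj : (G ⊔ edge x y).Reachable x y := by
    apply Adj.reachable
    rw [sup_adj, edge_adj]
    exact Or.inr ⟨Or.inl ⟨rfl, rfl⟩, hxy⟩
  constructor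
  · rintro ⟨p⟩
    induction p with
    | nil => exact Or.inl (Reachable.refl _)
    | @cons a b c h p ih =>
      have rx := Reachable.refl (G := G) x
      have ry := Reachable.refl (G := G) y
      rw [sup_adj, edge_adj] at h
      rcases h with h | ⟨⟨rfl, rfl⟩ | ⟨rfl, rfl⟩, -⟩
      · have e : ∀ z, G.Reachable z b → G.Reachable z a := fun z hz => hz.trans h.reachable.symm
        rcases ih with ih | ⟨ih₁, ih₂⟩
        · exact Or.inl (h.reachable.trans ih)
        · exact Or.inr ⟨ih₁.imp (e _) (e _), ih₂⟩
      · rcases ih with ih | ⟨-, ih⟩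
        · exact Or.inr ⟨Or.inl rx, Or.inr ih⟩
        · exact Or.inr ⟨Or.inl rx, ih⟩
      · rcases ih with ih | ⟨-, ih⟩
        · exact Or.inr ⟨Or.inr ry, Or.inl ih⟩
        · exact Or.inr ⟨Or.inr ry, ih⟩
  · rintro (h | ⟨h₁ | h₁, h₂ | h₂⟩)
    · exact hle h
    · exact hle (h₁.symm.trans h₂)
    · exact (hle h₁.symm).trans (hadj.trans (hle h₂))
    · exact (hle h₁.symm).trans (hadj.symm.trans (hle h₂))
    · exact hle (h₁.symm.trans h₂)

theorem card_connectedComponent_sup_edge [Finite V] (G : SimpleGraph V) {x y : V}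
    (h : ¬ G.Reachable x y) :
    Nat.card (G ⊔ edge x y).ConnectedComponent + 1 = Nat.card G.ConnectedComponent :=
  Nat.card_quotient_merge G.reachableSetoid (G ⊔ edge x y).reachableSetoid h
    (G.reachable_sup_edge_iff fun e => h (e ▸ Reachable.refl _))

theorem Connected.card_connectedComponent {G : SimpleGraph V} (h : G.Connected) :
    Nat.card G.ConnectedComponent = 1 := by
  have := h.nonempty
  have := h.preconnected.subsingleton_connectedComponent
  have : Nonempty G.ConnectedComponent := ⟨G.connectedComponentMk (Classical.arbitrary V)⟩
  exact Nat.card_eq_one_iff_unique.2 ⟨inferInstance, inferInstance⟩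

end SimpleGraph

/-! ### Inserting an edge into an embedding -/

namespace EmbeddedGraph

open Equiv.Perm

variable {V : Type u} {D : Type w}

theorem tail_facePerm (M : EmbeddedGraph V D) (d : D) :
    M.tail (M.facePerm d) = M.tail (M.rev d) := M.tail_rot _

/-- The vertices without darts. -/
def isolated (M : EmbeddedGraph V D) : Set V := {v | ∀ d, M.tail d ≠ v}

theorem card_face [Finite V] [Finite D] (M : EmbeddedGraph V D) :
    Nat.card M.Face = M.facePerm.cycleCount + M.isolated.ncard := Nat.card_sum

theorem graph_adj_rev (M : EmbeddedGraph V D) {d : D} (h : M.tail d ≠ M.tail (M.rev d)) :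
    M.graph.Adj (M.tail d) (M.tail (M.rev d)) :=
  (SimpleGraph.fromRel_adj _ _ _).2 ⟨h, Or.inl ⟨d, rfl, rfl⟩⟩

theorem graph_adj_iff (M : EmbeddedGraph V D) (x y : V) :
    M.graph.Adj x y ↔ x ≠ y ∧ ∃ d, M.tail d = x ∧ M.tail (M.rev d) = y := by
  rw [graph, SimpleGraph.fromRel_adj]
  refine and_congr_right fun _ => ⟨?_, Or.inl⟩
  rintro (h | ⟨d, h₁, h₂⟩)
  · exact h
  · exact ⟨M.rev d, h₂, by rw [M.rev_rev, h₁]⟩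

theorem reachable_rev (M : EmbeddedGraph V D) (d : D) :
    M.graph.Reachable (M.tail d) (M.tail (M.rev d)) := by
  by_cases h : M.tail d = M.tail (M.rev d)
  · rw [← h]
  · exact (M.graph_adj_rev h).reachable

theorem reachable_of_sameCycle_facePerm (M : EmbeddedGraph V D) {d e : D}
    (h : M.facePerm.SameCycle d e) : M.graph.Reachable (M.tail d) (M.tail e) := by
  refine SimpleGraph.ConnectedComponent.exact
    (h.map_eq (f := fun d => M.graph.connectedComponentMk (M.tail d)) fun d => ?_)
  rw [M.tail_facePerm]
  exact SimpleGraph.ConnectedComponent.sound (M.reachable_rev d).symm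

/-- The corner in front of the dart in `o` is at `x`, or `o` is empty and `x` has no darts. -/
def IsCorner (M : EmbeddedGraph V D) (x : V) (o : Option D) : Prop :=
  (∀ a ∈ o, M.tail a = x) ∧ (o = none → ∀ d, M.tail d ≠ x)

theorem exists_isCorner (M : EmbeddedGraph V D) (x : V) : ∃ o, M.IsCorner x o := by
  by_cases h : ∃ d, M.tail d = x
  · obtain ⟨d, hd⟩ := h
    exact ⟨some d, by simp [hd], by simp⟩
  · exact ⟨none, by simp, fun _ d hd => h ⟨d, hd⟩⟩

open Classical in
/-- The rotation after a new edge has been inserted at two corners. -/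
noncomputable def addEdgeRot (M : EmbeddedGraph V D) (o o' : Option D) :
    Equiv.Perm (D ⊕ Bool) :=
  attach (attach (Equiv.sumCongr M.rot 1) (o'.map Sum.inl) (Sum.inr true))
    (o.map Sum.inl) (Sum.inr false)

theorem sameCycle_addEdgeRot [Finite D] (M : EmbeddedGraph V D) {x y : V} (hxy : x ≠ y)
    {o o' : Option D} (ho : M.IsCorner x o) (ho' : M.IsCorner y o') (d e : D ⊕ Bool) :
    (M.addEdgeRot o o').SameCycle d e ↔
      Sum.elim M.tail (fun c => if c then y else x) d =
        Sum.elim M.tail (fun c => if c then y else x) e := by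
  classical
  -- Before the attachments each new dart is a vertex of its own, with a label in `Bool`; the
  -- attachments relabel `true` as `y` and `false` as `x`.
  have h0 : ∀ d e : D ⊕ Bool, SameCycle (Equiv.sumCongr M.rot 1) d e ↔
      (Sum.map M.tail id d : V ⊕ Bool) = Sum.map M.tail id e := by
    rintro (d | d) (e | e)
    · rw [sameCycle_sumCongr_inl, M.sameCycle_rot_iff]
      simp
    · simpa using not_sameCycle_sumCongr_inl_inr M.rot 1 d e
    · simpa using fun h => not_sameCycle_sumCongr_inl_inr M.rot 1 e d (SameCycle.symm h)
    · rw [sameCycle_sumCongr_inr]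
      simp
  have h1 := sameCycle_attach h0 (o := o'.map Sum.inl) (p := Sum.inr true) (v := Sum.inl y)
    (by
      cases o' with
      | none =>
        have := ho'.2 rfl
        simpa using this
      | some b =>
        have := ho'.1 b rfl
        simp [this])
    (by simp)
  have h2 := sameCycle_attach h1 (o := o.map Sum.inl) (p := Sum.inr false) (v := Sum.inl x)
    (by
      cases o with
      | none =>
        have hx := ho.2 rfl
        refine ⟨by simp, fun _ d => ?_⟩
        rcases d with d | d | d
        · simpa using hx d
        · simp
        · simp only [Sum.map_inr, id, if_true, ne_eq, Sum.inl.injEq]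
          exact hxy.symm
      | some b =>
        have := ho.1 b rfl
        simp [this])
    (by simp)
  rw [addEdgeRot]
  refine Iff.trans (by convert h2 d e) ?_
  rcases d with d | d | d <;> rcases e with e | e | e <;> simp

/-- The graph with a new edge from `x` to `y`, inserted at the corners `o` and `o'`. -/
noncomputable def addEdge [Finite D] (M : EmbeddedGraph V D) {x y : V} (hxy : x ≠ y)
    {o o' : Option D} (ho : M.IsCorner x o) (ho' : M.IsCorner y o') :
    EmbeddedGraph V (D ⊕ Bool) where
  tail := Sum.elim M.tail (fun c => if c then y else x)
  rev := Equiv.sumCongr M.rev (Equiv.swap false true)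
  rot := M.addEdgeRot o o'
  rev_rev := by rintro (d | d | d) <;> simp [M.rev_rev]
  rev_ne := by rintro (d | d | d) <;> simp [M.rev_ne]
  sameCycle_rot_iff := M.sameCycle_addEdgeRot hxy ho ho'

section addEdge

variable [Finite D] (M : EmbeddedGraph V D) {x y : V} (hxy : x ≠ y)
  {o o' : Option D} (ho : M.IsCorner x o) (ho' : M.IsCorner y o')

open Classical in
-- The transpositions multiply from the left and `rev` from the right, so they act on faces exactly
-- as on vertices. The new darts start as the facial walk of a separate edge.
theorem facePerm_addEdge : (M.addEdge hxy ho ho').facePerm =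
    attach (attach (Equiv.sumCongr M.facePerm (Equiv.swap false true))
      (o'.map Sum.inl) (Sum.inr true)) (o.map Sum.inl) (Sum.inr false) := by
  have : (Equiv.sumCongr M.facePerm (Equiv.swap false true) : Equiv.Perm (D ⊕ Bool)) =
      Equiv.sumCongr M.rot 1 * Equiv.sumCongr M.rev (Equiv.swap false true) := by
    ext (d | d) <;> rfl
  rw [this]
  simp only [facePerm, addEdge, addEdgeRot, attach, mul_assoc]

theorem graph_addEdge : (M.addEdge hxy ho ho').graph = M.graph ⊔ SimpleGraph.edge x y := by
  ext u v
  rw [SimpleGraph.sup_adj, SimpleGraph.edge_adj, graph_adj_iff, graph_adj_iff]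
  simp only [addEdge, Sum.exists, Bool.exists_bool, Sum.elim_inl, Sum.elim_inr,
    Equiv.sumCongr_apply, Sum.map_inl, Sum.map_inr, Equiv.swap_apply_left,
    Equiv.swap_apply_right, if_true, Bool.false_eq_true, if_false]
  grind

theorem ncard_isolated_addEdge [Finite V] :
    (M.addEdge hxy ho ho').isolated.ncard + (if o = none then 1 else 0) +
      (if o' = none then 1 else 0) = M.isolated.ncard := by
  have hI : (M.addEdge hxy ho ho').isolated = (M.isolated \ {x}) \ {y} := by
    ext v
    simp only [isolated, addEdge, Set.mem_ofPred_eq, Sum.forall, Sum.elim_inl, Sum.elim_inr,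
      Bool.forall_bool, Set.mem_sdiff, Set.mem_singleton_iff, if_true, Bool.false_eq_true, if_false]
    grind
  have key : ∀ (s : Set V) (z : V) (c : Option D), (c = none ↔ z ∈ s) →
      (s \ {z}).ncard + (if c = none then 1 else 0) = s.ncard := by
    intro s z c hc
    split_ifs with h
    · exact Set.ncard_sdiff_singleton_add_one (hc.1 h)
    · rw [Set.sdiff_singleton_eq_self (fun hz => h (hc.2 hz)), add_zero]
  have hc : ∀ z c, M.IsCorner z c → (c = none ↔ z ∈ M.isolated) := by
    intro z c hz
    refine ⟨hz.2, fun h => ?_⟩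
    cases c with
    | none => rfl
    | some a => exact absurd (hz.1 a rfl) (h a)
  rw [hI, add_right_comm, key _ y o' ?_, key _ x o (hc x o ho)]
  rw [hc y o' ho']
  simp [hxy.symm]

theorem cycleCount_swap_false_true : (Equiv.swap false true).cycleCount = 1 := by
  refine Nat.card_eq_one_iff_unique.2 ⟨⟨fun p q => ?_⟩, ⟨Quotient.mk _ true⟩⟩
  induction p using Quotient.inductionOn with | _ c
  induction q using Quotient.inductionOn with | _ d
  refine Quotient.sound ?_
  have h : (Equiv.swap false true).SameCycle false true := ⟨1, by simp⟩
  cases c <;> cases d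
  exacts [SameCycle.refl _ _, h, SameCycle.symm h, SameCycle.refl _ _]

open Classical in
theorem cycleCount_attach_facePerm :
    (attach (Equiv.sumCongr M.facePerm (Equiv.swap false true))
      (o'.map Sum.inl) (Sum.inr true)).cycleCount + (if o' = none then 0 else 1) =
        M.facePerm.cycleCount + 1 := by
  have h := cycleCount_attach (σ := Equiv.sumCongr M.facePerm (Equiv.swap false true))
      (o := o'.map Sum.inl) (p := Sum.inr true) (by
        simpa using fun a _ => not_sameCycle_sumCongr_inl_inr _ _ _ _)
  rw [cycleCount_sumCongr, cycleCount_swap_false_true] at h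
  simpa using h

/-- Each attachment merges two facial walks, or removes the face of an isolated end. Together with
the walk of the new edge this loses one face, while one edge is gained and one component lost. -/
theorem isPlane_addEdge_of_not_reachable [Finite V] (hM : M.IsPlane)
    (h : ¬ M.graph.Reachable x y) : (M.addEdge hxy ho ho').IsPlane := by
  classical
  have h1 := M.cycleCount_attach_facePerm (o' := o')
  have h2 := cycleCount_attach (σ := attach (Equiv.sumCongr M.facePerm (Equiv.swap false true))
      (o'.map Sum.inl) (Sum.inr true)) (o := o.map Sum.inl) (p := Sum.inr false) (by
    intro a ha hs
    obtain ⟨a, hao, rfl⟩ := Option.mem_map.1 ha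
    cases o' with
    | none =>
      rw [attach, Option.map_none, Option.elim, one_mul] at hs
      exact not_sameCycle_sumCongr_inl_inr _ _ _ _ hs
    | some b =>
      rcases hs.of_swap_mul with hs | ⟨hs | hs, -⟩
      · exact not_sameCycle_sumCongr_inl_inr _ _ _ _ hs
      · rw [sameCycle_sumCongr_inl] at hs
        have := M.reachable_of_sameCycle_facePerm hs
        rw [ho'.1 b rfl, ho.1 a hao] at this
        exact h this.symm
      · exact not_sameCycle_sumCongr_inl_inr _ _ _ _ hs.symm)
  rw [← facePerm_addEdge M hxy ho ho'] at h2
  have h3 := M.ncard_isolated_addEdge hxy ho ho'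
  have h4 := M.graph.card_connectedComponent_sup_edge h
  simp only [Option.map_eq_none_iff] at h2
  unfold IsPlane at *
  rw [card_face] at *
  rw [graph_addEdge, Nat.card_sum, Nat.card_eq_fintype_card (α := Bool), Fintype.card_bool]
  split_ifs at h1 h2 h3 <;> omega

/-- The first attachment joins the new edge to the face; the second acts within that one cycle and
cuts it in two. One edge and one face are gained. -/
theorem isPlane_addEdge_of_sameCycle [Finite V] (hM : M.IsPlane) (hc : M.graph.Connected)
    {a b : D} (hab : M.facePerm.SameCycle a b) (ha : M.IsCorner x (some a))
    (hb : M.IsCorner y (some b)) : (M.addEdge hxy ha hb).IsPlane := by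
  classical
  have h1 := M.cycleCount_attach_facePerm (o' := some b)
  have h2 : (M.addEdge hxy ha hb).facePerm.cycleCount =
      (attach (Equiv.sumCongr M.facePerm (Equiv.swap false true))
        ((some b).map Sum.inl) (Sum.inr true)).cycleCount + 1 := by
    rw [facePerm_addEdge]
    refine cycleCount_swap_mul (by simp) ?_
    refine (sameCycle_swap_mul_iff (not_sameCycle_sumCongr_inl_inr _ _ _ _) _ _).2
      (Or.inr ⟨Or.inl ?_, Or.inr ?_⟩)
    · rw [sameCycle_sumCongr_inl]
      exact hab.symm
    · rw [sameCycle_sumCongr_inr]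
      exact ⟨1, by simp⟩
  have h3 := M.ncard_isolated_addEdge hxy ha hb
  have h4 := (hc.mono (le_sup_left (b := SimpleGraph.edge x y))).card_connectedComponent
  have h5 := hc.card_connectedComponent
  unfold IsPlane at *
  rw [card_face] at *
  rw [graph_addEdge, Nat.card_sum, Nat.card_eq_fintype_card (α := Bool), Fintype.card_bool]
  simp only [reduceCtorEq, if_false] at h1 h2 h3
  omega

end addEdge

/-- No loops and no multiple edges. -/
def IsSimple (M : EmbeddedGraph V D) : Prop :=
  (∀ d, M.tail d ≠ M.tail (M.rev d)) ∧
    ∀ d e, M.tail d = M.tail e → M.tail (M.rev d) = M.tail (M.rev e) → d = e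

end EmbeddedGraph

/-! ### From embeddings on arbitrary darts to rotation systems -/

namespace RotationSystem

variable {V : Type u} {G : SimpleGraph V} (R : RotationSystem G)

theorem graph_embedding : R.embedding.graph = G := by
  ext u v
  rw [EmbeddedGraph.graph_adj_iff]
  constructor
  · rintro ⟨-, d, rfl, rfl⟩
    exact d.adj
  · intro h
    exact ⟨h.ne, ⟨(u, v), h⟩, rfl, rfl⟩

theorem isSimple_embedding : R.embedding.IsSimple :=
  ⟨fun d => d.adj.ne, fun _ _ h₁ h₂ => SimpleGraph.Dart.ext _ _ (Prod.ext h₁ h₂)⟩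

end RotationSystem

namespace EmbeddedGraph

open Equiv.Perm

variable {V : Type u} {D : Type w}

/-- In a simple embedding a dart is determined by its two ends, so the whole structure transports to
the darts of the underlying graph. This lets an embedding built by `addEdge` contradict maximality.
-/
theorem isPlanar_graph (M : EmbeddedGraph V D) (hs : M.IsSimple) (hM : M.IsPlane) :
    IsPlanar M.graph := by
  let f : D → M.graph.Dart := fun d =>
    ⟨(M.tail d, M.tail (M.rev d)), M.graph_adj_rev (hs.1 d)⟩
  have hf : Function.Bijective f := by
    constructor
    · intro d e hde
      have := congrArg SimpleGraph.Dart.toProd hde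
      exact hs.2 d e (congrArg Prod.fst this) (congrArg Prod.snd this)
    · intro d
      obtain ⟨-, e, h₁, h₂⟩ := (M.graph_adj_iff _ _).1 d.adj
      exact ⟨e, SimpleGraph.Dart.ext _ _ (Prod.ext h₁ h₂)⟩
  let ε : D ≃ M.graph.Dart := Equiv.ofBijective f hf
  have hrot : ∀ d, ε (M.rot d) = ε.permCongr M.rot (ε d) := by simp
  let R : RotationSystem M.graph :=
    { rot := ε.permCongr M.rot
      sameCycle_rot_iff := by
        intro d e
        obtain ⟨d, rfl⟩ := ε.surjective d
        obtain ⟨e, rfl⟩ := ε.surjective e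
        rw [sameCycle_iff_of_map M.rot ε _ hrot, M.sameCycle_rot_iff]
        rfl }
  have hrev : ∀ d, ε (M.rev d) = R.embedding.rev (ε d) := by
    intro d
    refine SimpleGraph.Dart.ext _ _ (Prod.ext rfl ?_)
    change M.tail (M.rev (M.rev d)) = _
    rw [M.rev_rev]
    rfl
  have hface : ∀ d, ε (M.facePerm d) = R.embedding.facePerm (ε d) := by
    intro d
    rw [facePerm, Equiv.Perm.mul_apply, hrot, hrev]
    rfl
  have hsc := sameCycle_iff_of_map M.facePerm ε _ hface
  have e₁ : Quotient (Equiv.Perm.SameCycle.setoid M.facePerm) ≃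
      Quotient (Equiv.Perm.SameCycle.setoid R.embedding.facePerm) :=
    Quotient.congr ε fun d e => (hsc d e).symm
  have e₂ : {v : V // ∀ d, M.tail d ≠ v} ≃ {v : V // ∀ d, R.embedding.tail d ≠ v} :=
    Equiv.subtypeEquivRight fun v => ε.forall_congr (fun d => Iff.rfl)
  refine ⟨R, ?_⟩
  unfold IsPlane at *
  have hcard : Nat.card M.Face = Nat.card R.embedding.Face :=
    Nat.card_congr (Equiv.sumCongr e₁ e₂)
  rw [R.graph_embedding, ← Nat.card_congr ε, ← hcard]
  exact hM

end EmbeddedGraph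

theorem SimpleGraph.finite_dart {V : Type u} [Finite V] (G : SimpleGraph V) : Finite G.Dart :=
  Finite.of_injective SimpleGraph.Dart.toProd SimpleGraph.Dart.toProd_injective

namespace EmbeddedGraph

variable {V : Type u} {D : Type w}

theorem isSimple_addEdge [Finite D] (M : EmbeddedGraph V D) {x y : V} (hxy : x ≠ y)
    {o o' : Option D} (ho : M.IsCorner x o) (ho' : M.IsCorner y o') (hs : M.IsSimple)
    (hadj : ¬ M.graph.Adj x y) : (M.addEdge hxy ho ho').IsSimple := by
  have h1 : ∀ d, ¬ (M.tail d = x ∧ M.tail (M.rev d) = y) := fun d h =>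
    hadj ((M.graph_adj_iff _ _).2 ⟨hxy, d, h⟩)
  have h2 : ∀ d, ¬ (M.tail d = y ∧ M.tail (M.rev d) = x) := fun d h =>
    h1 (M.rev d) ⟨h.2, by rw [M.rev_rev, h.1]⟩
  constructor
  · rintro (d | d | d)
    · exact hs.1 d
    · simpa [addEdge] using hxy
    · simpa [addEdge] using hxy.symm
  · rintro (d | d | d) (e | e | e)
    · simpa [addEdge] using hs.2 d e
    all_goals simp [addEdge]
    all_goals grind

end EmbeddedGraph

/-! ### Consequences of maximality -/

theorem IsMaximalPlanar.adj_of_isSimple {V : Type u} {D : Type w} {G : SimpleGraph V}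
    (hG : IsMaximalPlanar G) {x y : V} (hxy : x ≠ y) (M : EmbeddedGraph V D)
    (hM : M.graph = G ⊔ SimpleGraph.edge x y) (hs : M.IsSimple) (hp : M.IsPlane) :
    G.Adj x y := by
  have h := hG.le_of_ge (hM ▸ M.isPlanar_graph hs hp) le_sup_left
  refine h ?_
  rw [SimpleGraph.sup_adj, SimpleGraph.edge_adj]
  exact Or.inr ⟨Or.inl ⟨rfl, rfl⟩, hxy⟩

theorem IsMaximalPlanar.preconnected {V : Type u} [Finite V] {G : SimpleGraph V}
    (hG : IsMaximalPlanar G) (R : RotationSystem G) (hR : R.embedding.IsPlane) : G.Preconnected := by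
  intro x y
  by_contra h
  have hxy : x ≠ y := fun e => h (e ▸ SimpleGraph.Reachable.refl _)
  have := G.finite_dart
  obtain ⟨o, ho⟩ := R.embedding.exists_isCorner x
  obtain ⟨o', ho'⟩ := R.embedding.exists_isCorner y
  refine h (hG.adj_of_isSimple hxy (R.embedding.addEdge hxy ho ho') ?_ ?_ ?_).reachable
  · rw [EmbeddedGraph.graph_addEdge, R.graph_embedding]
  · exact R.embedding.isSimple_addEdge hxy ho ho' R.isSimple_embedding
      (by rw [R.graph_embedding]; exact fun e => h e.reachable)
  · exact R.embedding.isPlane_addEdge_of_not_reachable hxy ho ho' hR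
      (by rwa [R.graph_embedding])

theorem IsMaximalPlanar.adj_of_sameCycle {V : Type u} [Finite V] {G : SimpleGraph V}
    (hG : IsMaximalPlanar G) (R : RotationSystem G) (hR : R.embedding.IsPlane) {a b : G.Dart}
    (hab : R.embedding.facePerm.SameCycle a b) (hne : a.fst ≠ b.fst) : G.Adj a.fst b.fst := by
  by_contra h
  have := G.finite_dart
  have ha : R.embedding.IsCorner a.fst (some a) := ⟨by rintro _ ⟨⟩; rfl, by simp⟩
  have hb : R.embedding.IsCorner b.fst (some b) := ⟨by rintro _ ⟨⟩; rfl, by simp⟩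
  have hc : G.Connected := (SimpleGraph.connected_iff _).2 ⟨hG.preconnected R hR, ⟨a.fst⟩⟩
  refine h (hG.adj_of_isSimple hne (R.embedding.addEdge hne ha hb) ?_ ?_ ?_)
  · rw [EmbeddedGraph.graph_addEdge, R.graph_embedding]
  · exact R.embedding.isSimple_addEdge hne ha hb R.isSimple_embedding
      (by rwa [R.graph_embedding])
  · exact R.embedding.isPlane_addEdge_of_sameCycle hne hR (by rwa [R.graph_embedding]) hab ha hb

/-! ### Cycles and faces modulo two -/

namespace EmbeddedGraph

open Equiv.Perm Module

variable {V : Type u} {D : Type w}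

/-- Invariance under `rot` makes `f` constant at each vertex, and invariance under `rev` carries its
value across edges. -/
theorem eq_of_reachable (M : EmbeddedGraph V D) {β : Type*} {f : D → β}
    (hrot : ∀ d, f (M.rot d) = f d) (hrev : ∀ d, f (M.rev d) = f d) {u v : V}
    (h : M.graph.Reachable u v) : ∀ {d e : D}, M.tail d = u → M.tail e = v → f d = f e := by
  have key : ∀ {d e}, M.tail d = M.tail e → f d = f e := fun hde =>
    ((M.sameCycle_rot_iff _ _).2 hde).map_eq hrot
  obtain ⟨p⟩ := h
  induction p with
  | nil => exact fun hd he => key (hd.trans he.symm)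
  | cons h p ih =>
    intro d e hd he
    obtain ⟨-, c, hc, hc'⟩ := (M.graph_adj_iff _ _).1 h
    rw [key (hd.trans hc.symm), ← hrev c]
    exact ih hc' he

theorem sameCycle_rev_iff (M : EmbeddedGraph V D) (d e : D) :
    M.rev.SameCycle d e ↔ e = d ∨ e = M.rev d := by
  constructor
  · intro h
    have key : ∀ x, (M.rev x = d ∨ M.rev x = M.rev d) = (x = d ∨ x = M.rev d) := by
      intro x
      rw [M.rev.injective.eq_iff, eq_iff_iff, or_comm]
      refine or_congr_right ⟨fun e => ?_, fun e => ?_⟩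
      · rw [← e, M.rev_rev]
      · rw [e, M.rev_rev]
    exact (h.map_eq (f := fun x => x = d ∨ x = M.rev d) key).mp (Or.inl rfl)
  · rintro (rfl | rfl)
    · exact SameCycle.refl _ _
    · exact ⟨1, by simp⟩

theorem two_mul_cycleCount_rev [Finite D] (M : EmbeddedGraph V D) :
    2 * M.rev.cycleCount = Nat.card D := by
  classical
  have := Fintype.ofFinite D
  have := Fintype.ofFinite (Quotient (SameCycle.setoid M.rev))
  rw [cycleCount, Nat.card_eq_fintype_card, Nat.card_eq_fintype_card, ← Finset.card_univ,
    ← Finset.card_univ, mul_comm]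
  rw [Finset.card_eq_sum_card_fiberwise (t := Finset.univ)
    (f := fun d => Quotient.mk (SameCycle.setoid M.rev) d) (fun _ _ => Finset.mem_univ _)]
  refine (Finset.sum_const_nat fun q _ => ?_).symm
  induction q using Quotient.inductionOn with | _ d
  rw [← Finset.card_pair (M.rev_ne d).symm]
  congr 1
  ext e
  simp only [Finset.mem_filter, Finset.mem_univ, true_and, Finset.mem_insert,
    Finset.mem_singleton, Quotient.eq]
  exact sameCycle_comm.trans (M.sameCycle_rev_iff d e)

/-- The edges, as pairs of opposite darts. -/
abbrev Edge (M : EmbeddedGraph V D) : Type w := Quotient (SameCycle.setoid M.rev)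

/-- The edge of a dart. -/
abbrev edge (M : EmbeddedGraph V D) (d : D) : M.Edge := Quotient.mk _ d

/-- The facial walk through a dart. -/
abbrev faceOf (M : EmbeddedGraph V D) (d : D) : Quotient (SameCycle.setoid M.facePerm) :=
  Quotient.mk _ d

theorem edge_eq_iff (M : EmbeddedGraph V D) (d e : D) :
    M.edge e = M.edge d ↔ e = d ∨ e = M.rev d :=
  Quotient.eq.trans (sameCycle_comm.trans (M.sameCycle_rev_iff d e))

theorem edge_rev (M : EmbeddedGraph V D) (d : D) : M.edge (M.rev d) = M.edge d :=
  (M.edge_eq_iff _ _).2 (Or.inr rfl)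

theorem faceOf_rot (M : EmbeddedGraph V D) (d : D) : M.faceOf (M.rot d) = M.faceOf (M.rev d) := by
  refine Quotient.sound (SameCycle.symm ⟨1, ?_⟩)
  rw [zpow_one, facePerm, mul_apply, M.rev_rev]

/-- The boundary of a set of edges, modulo two. -/
def boundaryMap [Fintype D] [DecidableEq V] (M : EmbeddedGraph V D) : (M.Edge → ZMod 2) →ₗ[ZMod 2] (V → ZMod 2) where
  toFun h v := ∑ d, if M.tail d = v then h (M.edge d) else 0
  map_add' g h := by
    ext v
    rw [Pi.add_apply, ← Finset.sum_add_distrib]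
    exact Finset.sum_congr rfl fun d _ => by split_ifs <;> simp
  map_smul' c h := by
    ext v
    rw [Pi.smul_apply, smul_eq_mul, Finset.mul_sum]
    exact Finset.sum_congr rfl fun d _ => by split_ifs <;> simp

/-- The edges at which the labels of the faces change, modulo two. -/
def faceBoundary (M : EmbeddedGraph V D) :
    (Quotient (SameCycle.setoid M.facePerm) → ZMod 2) →ₗ[ZMod 2] (M.Edge → ZMod 2) where
  toFun φ := Quotient.lift (fun d => φ (M.faceOf d) + φ (M.faceOf (M.rev d))) (by
    intro d e h
    rcases (M.sameCycle_rev_iff d e).1 h with rfl | rfl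
    · rfl
    · simp only [M.rev_rev, add_comm])
  map_add' g h := by
    ext q
    induction q using Quotient.inductionOn with | _ d
    simp only [Quotient.lift_mk, Pi.add_apply]
    ring
  map_smul' c h := by
    ext q
    induction q using Quotient.inductionOn with | _ d
    simp [mul_add]

theorem faceBoundary_edge (M : EmbeddedGraph V D)
    (φ : Quotient (SameCycle.setoid M.facePerm) → ZMod 2) (d : D) :
    M.faceBoundary φ (M.edge d) = φ (M.faceOf d) + φ (M.faceOf (M.rev d)) := rfl

/-- Since `rev d` and `rot d` lie on the same face, every corner at a vertex is counted twice, once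
from each of its two sides. -/
theorem boundaryMap_faceBoundary [Fintype D] [DecidableEq V] (M : EmbeddedGraph V D)
    (φ : Quotient (SameCycle.setoid M.facePerm) → ZMod 2) :
    M.boundaryMap (M.faceBoundary φ) = 0 := by
  ext v
  change ∑ d, (if M.tail d = v then M.faceBoundary φ (M.edge d) else 0) = 0
  have h1 : ∀ d, (if M.tail d = v then M.faceBoundary φ (M.edge d) else 0) =
      (if M.tail d = v then φ (M.faceOf d) else 0) +
        (if M.tail (M.rot d) = v then φ (M.faceOf (M.rot d)) else 0) := by
    intro d
    rw [faceBoundary_edge, M.tail_rot, M.faceOf_rot]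
    split_ifs <;> simp
  rw [Finset.sum_congr rfl fun d _ => h1 d, Finset.sum_add_distrib,
    Equiv.sum_comp M.rot (fun d => if M.tail d = v then φ (M.faceOf d) else 0)]
  exact CharTwo.add_self_eq_zero _

theorem boundaryMap_single [Fintype D] [DecidableEq V] (M : EmbeddedGraph V D)
    [DecidableEq M.Edge] (d : D) :
    M.boundaryMap (Pi.single (M.edge d) 1) =
      Pi.single (M.tail d) 1 + Pi.single (M.tail (M.rev d)) 1 := by
  classical
  ext v
  change ∑ e, (if M.tail e = v then (Pi.single (M.edge d) (1 : ZMod 2) : M.Edge → ZMod 2)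
    (M.edge e) else 0) = _
  rw [← Finset.sum_subset (Finset.subset_univ {d, M.rev d}), Finset.sum_pair (M.rev_ne d).symm]
  · rw [M.edge_rev, Pi.single_eq_same, Pi.add_apply, Pi.single_apply, Pi.single_apply]
    simp only [eq_comm]
  · intro e _ he
    rw [Pi.single_eq_of_ne, ite_self]
    rw [ne_eq, M.edge_eq_iff]
    simpa using he

/-- Modulo the range, the basis vectors of adjacent vertices agree, so the range and a single basis
vector span everything. -/
theorem card_le_finrank_range_boundaryMap [Fintype D] [DecidableEq V] [Finite V] (M : EmbeddedGraph V D)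
    (hc : M.graph.Connected) :
    Nat.card V ≤ finrank (ZMod 2) (LinearMap.range M.boundaryMap) + 1 := by
  classical
  have := Fintype.ofFinite V
  obtain ⟨x⟩ := hc.nonempty
  set B := LinearMap.range M.boundaryMap
  set S := Submodule.span (ZMod 2) {(Pi.single x 1 : V → ZMod 2)}
  have hadj : ∀ u v, M.graph.Adj u v →
      (Pi.single u 1 + Pi.single v 1 : V → ZMod 2) ∈ B := by
    intro u v h
    obtain ⟨-, d, rfl, rfl⟩ := (M.graph_adj_iff _ _).1 h
    exact ⟨_, M.boundaryMap_single d⟩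
  have hmem : ∀ u v, M.graph.Reachable u v → (Pi.single v 1 : V → ZMod 2) ∈ B ⊔ S →
      (Pi.single u 1 : V → ZMod 2) ∈ B ⊔ S := by
    rintro u v ⟨p⟩ hv
    induction p with
    | nil => exact hv
    | @cons a b c h p ih =>
      have h1 := (B ⊔ S).sub_mem (Submodule.mem_sup_left (hadj a b h)) (ih hv)
      rwa [add_sub_cancel_right] at h1
  have htop : B ⊔ S = ⊤ := by
    rw [eq_top_iff, ← (Pi.basisFun (ZMod 2) V).span_eq, Submodule.span_le]
    rintro _ ⟨v, rfl⟩
    rw [Pi.basisFun_apply]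
    exact hmem v x (hc.preconnected v x)
      (Submodule.mem_sup_right (Submodule.mem_span_singleton_self _))
  have h1 := Submodule.finrank_add_le_finrank_add_finrank B S
  rw [htop, finrank_top, finrank_fintype_fun_eq_card] at h1
  have h2 : finrank (ZMod 2) S ≤ 1 := by
    simpa using finrank_span_le_card (R := ZMod 2) ({(Pi.single x 1 : V → ZMod 2)} : Set _)
  rw [Nat.card_eq_fintype_card]
  omega

theorem finrank_ker_faceBoundary_le [Finite D] (M : EmbeddedGraph V D) (hc : M.graph.Connected) :
    finrank (ZMod 2) (LinearMap.ker M.faceBoundary) ≤ 1 := by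
  classical
  have hle : LinearMap.ker M.faceBoundary ≤ Submodule.span (ZMod 2) {fun _ => 1} := by
    intro φ hφ
    rw [LinearMap.mem_ker] at hφ
    have hrev : ∀ d, φ (M.faceOf (M.rev d)) = φ (M.faceOf d) := by
      intro d
      have := congrFun hφ (M.edge d)
      rw [faceBoundary_edge, Pi.zero_apply, CharTwo.add_eq_zero] at this
      exact this.symm
    have hrot : ∀ d, φ (M.faceOf (M.rot d)) = φ (M.faceOf d) := by
      intro d
      rw [M.faceOf_rot, hrev]
    rw [Submodule.mem_span_singleton]
    rcases isEmpty_or_nonempty D with h | ⟨⟨d⟩⟩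
    · refine ⟨0, ?_⟩
      ext q
      induction q using Quotient.inductionOn with | _ d
      exact h.elim d
    · refine ⟨φ (M.faceOf d), ?_⟩
      ext q
      induction q using Quotient.inductionOn with | _ e
      simpa using M.eq_of_reachable (f := fun d => φ (M.faceOf d)) hrot hrev
        (hc.preconnected (M.tail d) (M.tail e)) rfl rfl
  refine (Submodule.finrank_mono hle).trans ?_
  simpa using finrank_span_le_card (R := ZMod 2)
    ({fun _ => 1} : Set (Quotient (SameCycle.setoid M.facePerm) → ZMod 2))

/-- In a plane graph every cycle is the boundary of a set of faces. -/
theorem IsPlane.range_faceBoundary [Fintype D] [DecidableEq V] [Finite V] {M : EmbeddedGraph V D} (hM : M.IsPlane)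
    (hc : M.graph.Connected) (hi : M.isolated = ∅) :
    LinearMap.range M.faceBoundary = LinearMap.ker M.boundaryMap := by
  classical
  have := Fintype.ofFinite V
  have := Fintype.ofFinite M.Edge
  have := Fintype.ofFinite (Quotient (SameCycle.setoid M.facePerm))
  refine Submodule.eq_of_le_of_finrank_le ?_ ?_
  · rintro _ ⟨φ, rfl⟩
    exact M.boundaryMap_faceBoundary φ
  -- The range of `faceBoundary` has dimension at least F - 1, the kernel of `boundaryMap` at most E
  -- - V + 1, and Euler's formula equates these two numbers.
  have h1 := M.card_le_finrank_range_boundaryMap hc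
  have h2 := M.finrank_ker_faceBoundary_le hc
  have h3 := M.boundaryMap.finrank_range_add_finrank_ker
  have h4 := M.faceBoundary.finrank_range_add_finrank_ker
  rw [finrank_fintype_fun_eq_card, ← Nat.card_eq_fintype_card] at h3 h4
  have h5 := M.two_mul_cycleCount_rev
  unfold IsPlane at hM
  rw [card_face, hi, Set.ncard_empty, hc.card_connectedComponent] at hM
  change 2 * Nat.card M.Edge = _ at h5
  rw [cycleCount] at hM
  omega

/-- A Jordan theorem for closed walks of three edges: `φ` tells the side on which the face of a dart
lies, and `h` is the mod 2 indicator of the walk. Repeated edges may cancel, hence the distinctness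
conditions for `h b = 1`. -/
theorem IsPlane.exists_separation [Finite V] [Finite D] {M : EmbeddedGraph V D} (hM : M.IsPlane)
    (hc : M.graph.Connected) (hi : M.isolated = ∅) {a b c : D}
    (hab : M.tail (M.rev a) = M.tail b) (hbc : M.tail (M.rev b) = M.tail c)
    (hca : M.tail (M.rev c) = M.tail a) :
    ∃ φ : D → ZMod 2, (∀ d, φ (M.facePerm d) = φ d) ∧ ∃ h : D → ZMod 2,
      (∀ d, φ (M.rev d) = φ d + h d) ∧ (∀ d, h (M.rev d) = h d) ∧
      (∀ d, M.edge d ≠ M.edge a → M.edge d ≠ M.edge b → M.edge d ≠ M.edge c → h d = 0) ∧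
      (M.edge b ≠ M.edge a → M.edge b ≠ M.edge c → h b = 1) := by
  classical
  have := Fintype.ofFinite D
  set h : M.Edge → ZMod 2 :=
    Pi.single (M.edge a) 1 + Pi.single (M.edge b) 1 + Pi.single (M.edge c) 1 with hh
  have hker : h ∈ LinearMap.ker M.boundaryMap := by
    rw [LinearMap.mem_ker, hh, map_add, map_add, boundaryMap_single, boundaryMap_single,
      boundaryMap_single, hab, hbc, hca]
    ext v
    simp only [Pi.add_apply, Pi.zero_apply]
    ring_nf
    simp [show (2 : ZMod 2) = 0 from rfl]
  rw [← hM.range_faceBoundary hc hi] at hker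
  obtain ⟨φ, hφ⟩ := hker
  refine ⟨fun d => φ (M.faceOf d), fun d => ?_, fun d => h (M.edge d), fun d => ?_, fun d => ?_,
    fun d h1 h2 h3 => ?_, fun h1 h2 => ?_⟩
  · exact congrArg φ (Quotient.sound (SameCycle.symm ⟨1, by simp⟩))
  · beta_reduce
    rw [← hφ, faceBoundary_edge, ← add_assoc, CharTwo.add_self_eq_zero, zero_add]
  · beta_reduce
    rw [M.edge_rev]
  · simp [hh, h1, h2, h3]
  · simp [hh, h1, h2]

end EmbeddedGraph

/-! ### Faces are triangles -/

namespace EmbeddedGraph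

open Equiv.Perm

variable {V : Type u} {D : Type w}

theorem edge_ne {M : EmbeddedGraph V D} {d e : D}
    (h : ¬ (M.tail d = M.tail e ∧ M.tail (M.rev d) = M.tail (M.rev e)))
    (h' : ¬ (M.tail d = M.tail (M.rev e) ∧ M.tail (M.rev d) = M.tail e)) :
    M.edge d ≠ M.edge e := by
  rw [ne_eq, M.edge_eq_iff]
  rintro (rfl | rfl)
  · exact h ⟨rfl, rfl⟩
  · exact h' ⟨rfl, by rw [M.rev_rev]⟩

/-- Any two vertices on the boundary of the same face are adjacent. -/
def CofacialAdj (M : EmbeddedGraph V D) : Prop :=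
  ∀ a b, M.facePerm.SameCycle a b → M.tail a ≠ M.tail b →
    ∃ d, M.tail d = M.tail a ∧ M.tail (M.rev d) = M.tail b

/-- If the facial walk turned back, its middle vertex would have degree one. The vertex after the
turn is either that leaf, making the graph a single edge, or cofacial and hence adjacent to it,
which forces a loop at its only neighbour. -/
theorem tail_facePerm_facePerm_ne [Finite V] {M : EmbeddedGraph V D} (hs : M.IsSimple)
    (hc : M.graph.Connected) (hi : M.isolated = ∅) (hn : 3 ≤ Nat.card V) (hf : M.CofacialAdj)
    (d : D) : M.tail (M.facePerm (M.facePerm d)) ≠ M.tail d := by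
  intro h
  set d₁ := M.facePerm d with hd₁
  set d₂ := M.facePerm d₁ with hd₂
  have t₁ : M.tail d₁ = M.tail (M.rev d) := M.tail_facePerm d
  have t₂ : M.tail d₂ = M.tail (M.rev d₁) := M.tail_facePerm d₁
  have e₁ : d₁ = M.rev d := hs.2 _ _ t₁ (by rw [M.rev_rev, ← t₂, h])
  have e₂ : d₂ = M.rot d := by rw [hd₂, facePerm, mul_apply, e₁, M.rev_rev]
  have r₁ : M.rot d₁ = d₁ := by
    have : M.rot (M.rev d) = d₁ := rfl
    rwa [← e₁] at this
  have huniq : ∀ e, M.tail e = M.tail d₁ → e = d₁ := fun e he =>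
    (((M.sameCycle_rot_iff _ _).2 he.symm).eq_of_left r₁).symm
  have t₃ := M.tail_facePerm d₂
  by_cases h3 : M.tail (M.facePerm d₂) = M.tail d₁
  · have e₃ : d₂ = d := hs.2 _ _ h (by rw [← t₃, h3, t₁])
    have r₂ : M.rot d = d := by rw [← e₂, e₃]
    have hall : ∀ e, e = d ∨ e = d₁ := by
      intro e
      have := M.eq_of_reachable (f := fun e => e = d ∨ e = d₁) (fun x => ?_) (fun x => ?_)
        (hc.preconnected (M.tail d) (M.tail e)) rfl rfl
      · exact this.mp (Or.inl rfl)
      · rw [← M.rot.injective.eq_iff (a := x) (b := d), ← M.rot.injective.eq_iff (a := x), r₁, r₂]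
      · rw [e₁, M.rev.injective.eq_iff, ← M.rev.injective.eq_iff (a := x) (b := M.rev d), M.rev_rev,
          or_comm]
    have : (Set.univ : Set V) ⊆ {M.tail d, M.tail d₁} := by
      intro v _
      have hv : v ∉ M.isolated := by rw [hi]; exact Set.notMem_empty v
      simp only [isolated, Set.mem_ofPred_eq, not_forall, not_not] at hv
      obtain ⟨e, rfl⟩ := hv
      rcases hall e with rfl | rfl
      · exact Or.inl rfl
      · exact Or.inr rfl
    have := Set.ncard_le_ncard this
    have h2 := Set.ncard_insert_le (M.tail d) {M.tail d₁}
    rw [Set.ncard_singleton] at h2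
    rw [Set.ncard_univ] at this
    omega
  · have hsc : M.facePerm.SameCycle d₁ (M.facePerm d₂) := ⟨2, rfl⟩
    obtain ⟨k, hk, hk'⟩ := hf _ _ hsc (Ne.symm h3)
    rw [huniq k hk, ← t₂, t₃] at hk'
    exact hs.1 _ hk'

/-- Otherwise the walk has four distinct consecutive vertices v0, v1, v2, v3, joined by chords `e`
from v2 to v0 and `k` from v1 to v3. The triangle v0v1v2 separates: `k` leaves v1 on the side
opposite to the face, whereas all darts at v3 are on the side of the face, and `k` does not cross
the triangle. -/
theorem IsPlane.tail_facePerm_pow_three [Finite V] [Finite D] {M : EmbeddedGraph V D}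
    (hM : M.IsPlane) (hs : M.IsSimple) (hc : M.graph.Connected) (hi : M.isolated = ∅)
    (hn : 3 ≤ Nat.card V) (hf : M.CofacialAdj) (d : D) :
    M.tail (M.facePerm (M.facePerm (M.facePerm d))) = M.tail d := by
  by_contra h30
  set d₁ := M.facePerm d with hd₁
  set d₂ := M.facePerm d₁ with hd₂
  set d₃ := M.facePerm d₂ with hd₃
  have t₁ : M.tail d₁ = M.tail (M.rev d) := M.tail_facePerm d
  have t₂ : M.tail d₂ = M.tail (M.rev d₁) := M.tail_facePerm d₁
  have t₃ : M.tail d₃ = M.tail (M.rev d₂) := M.tail_facePerm d₂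
  have h20 : M.tail d₂ ≠ M.tail d := tail_facePerm_facePerm_ne hs hc hi hn hf d
  have h31 : M.tail d₃ ≠ M.tail d₁ := tail_facePerm_facePerm_ne hs hc hi hn hf d₁
  have h01 : M.tail d ≠ M.tail d₁ := by rw [t₁]; exact hs.1 d
  have h12 : M.tail d₁ ≠ M.tail d₂ := by rw [t₂]; exact hs.1 d₁
  have h23 : M.tail d₂ ≠ M.tail d₃ := by rw [t₃]; exact hs.1 d₂
  obtain ⟨e, te, te'⟩ := hf d₂ d (SameCycle.symm ⟨2, rfl⟩) h20
  obtain ⟨k, tk, tk'⟩ := hf d₁ d₃ ⟨2, rfl⟩ h31.symm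
  obtain ⟨φ, hφ, h, hrev, hsymm, hzero, hone⟩ :=
    hM.exists_separation hc hi (a := d) (b := d₁) (c := e) t₁.symm (t₂.symm.trans te.symm) te'
  have hrot : ∀ x, φ (M.rot x) = φ x + h x := by
    intro x
    rw [← hrev, ← hφ (M.rev x), facePerm, mul_apply, M.rev_rev]
  have hd₁one : h d₁ = 1 := by
    refine hone (edge_ne ?_ ?_) (edge_ne ?_ ?_) <;> grind
  have hz : ∀ x, M.tail x = M.tail d₁ → x ≠ d₁ → x ≠ M.rev d → h x = 0 := by
    intro x hx h1 h0
    refine hzero x (fun he => ?_) (fun he => ?_) (fun he => ?_) <;>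
      rcases (M.edge_eq_iff _ _).1 he with rfl | rfl <;> grind
  have hz₃ : ∀ x, M.tail x = M.tail d₃ → h x = 0 := by
    intro x hx
    refine hzero x (fun he => ?_) (fun he => ?_) (fun he => ?_) <;>
      rcases (M.edge_eq_iff _ _).1 he with rfl | rfl <;> grind
  have rd : M.rot (M.rev d) = d₁ := rfl
  -- Turning around v1, the side changes after `d₁` and can change again only after `rev d`, where
  -- the turn is complete.
  have hconst : ∀ x, M.rot.SameCycle d₁ x → x = d₁ ∨ φ x = φ d₁ + 1 := by
    intro x hx
    obtain ⟨n, rfl⟩ := hx.exists_nat_pow_eq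
    induction n with
    | zero => exact Or.inl rfl
    | succ n ih =>
      have hn : M.rot.SameCycle d₁ ((M.rot ^ n) d₁) := ⟨n, rfl⟩
      have ht := (M.sameCycle_rot_iff _ _).1 hn
      rw [pow_succ', mul_apply]
      rcases ih hn with ih | ih
      · right
        rw [hrot, ih, hd₁one]
      · by_cases h1 : (M.rot ^ n) d₁ = d₁
        · right
          rw [hrot, h1, hd₁one]
        by_cases h0 : (M.rot ^ n) d₁ = M.rev d
        · left
          rw [h0, rd]
        · right
          rw [hrot, hz _ ht.symm h1 h0, add_zero, ih]
  have hk : φ k = φ d₁ + 1 := by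
    refine (hconst k ((M.sameCycle_rot_iff _ _).2 tk.symm)).resolve_left ?_
    rintro rfl
    exact h23 (t₂.trans tk')
  have hk' : φ (M.rev k) = φ k := by rw [hrev, ← hsymm, hz₃ _ tk', add_zero]
  have hcon : ∀ x, M.rot.SameCycle d₃ x → φ x = φ d₃ := by
    intro x hx
    obtain ⟨n, rfl⟩ := hx.exists_nat_pow_eq
    induction n with
    | zero => rfl
    | succ n ih =>
      have hn : M.rot.SameCycle d₃ ((M.rot ^ n) d₃) := ⟨n, rfl⟩
      rw [pow_succ', mul_apply, hrot, hz₃ _ ((M.sameCycle_rot_iff _ _).1 hn).symm, add_zero, ih hn]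
  have h1 := hcon _ ((M.sameCycle_rot_iff _ _).2 tk'.symm)
  have h2 : φ d₃ = φ d₁ := (hφ d₂).trans (hφ d₁)
  rw [hk', hk, h2] at h1
  simp at h1

theorem IsPlane.facePerm_pow_three [Finite V] [Finite D] {M : EmbeddedGraph V D}
    (hM : M.IsPlane) (hs : M.IsSimple) (hc : M.graph.Connected) (hi : M.isolated = ∅)
    (hn : 3 ≤ Nat.card V) (hf : M.CofacialAdj) (d : D) :
    M.facePerm (M.facePerm (M.facePerm d)) = d := by
  have h := hM.tail_facePerm_pow_three hs hc hi hn hf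
  exact hs.2 _ _ (h d) (by rw [← M.tail_facePerm, ← M.tail_facePerm d, h])

theorem sameCycle_facePerm_of_pow_three {M : EmbeddedGraph V D}
    (h : ∀ d, M.facePerm (M.facePerm (M.facePerm d)) = d) {d e : D}
    (hde : M.facePerm.SameCycle d e) :
    e = d ∨ e = M.facePerm d ∨ e = M.facePerm (M.facePerm d) := by
  have key : ∀ x, (M.facePerm x = d ∨ M.facePerm x = M.facePerm d ∨
      M.facePerm x = M.facePerm (M.facePerm d)) =
      (x = d ∨ x = M.facePerm d ∨ x = M.facePerm (M.facePerm d)) := by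
    intro x
    have h1 := M.facePerm.injective.eq_iff (a := x) (b := M.facePerm (M.facePerm d))
    rw [h d] at h1
    rw [h1, M.facePerm.injective.eq_iff, M.facePerm.injective.eq_iff, eq_iff_iff]
    tauto
  exact (hde.map_eq (f := fun x => x = d ∨ x = M.facePerm d ∨ x = M.facePerm (M.facePerm d))
    key).mp (Or.inl rfl)

end EmbeddedGraph

theorem IsMaximalPlanar.cofacialAdj {V : Type u} [Finite V] {G : SimpleGraph V}
    (hG : IsMaximalPlanar G) (R : RotationSystem G) (hR : R.embedding.IsPlane) :
    R.embedding.CofacialAdj := fun a b hab hne =>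
  ⟨⟨(a.fst, b.fst), hG.adj_of_sameCycle R hR hab hne⟩, rfl, rfl⟩

theorem RotationSystem.isolated_embedding {V : Type u} [Finite V] {G : SimpleGraph V}
    (R : RotationSystem G) (hc : G.Connected) (hn : 2 ≤ Nat.card V) :
    R.embedding.isolated = ∅ := by
  have : Nontrivial V := Finite.one_lt_card_iff_nontrivial.1 hn
  refine Set.eq_empty_of_forall_notMem fun v hv => ?_
  obtain ⟨w, hw⟩ := hc.preconnected.exists_adj_of_nontrivial v
  exact hv ⟨(v, w), hw⟩ rfl

theorem IsMaximalPlanar.facePerm_pow_three {V : Type u} [Finite V] {G : SimpleGraph V}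
    (hG : IsMaximalPlanar G) (R : RotationSystem G) (hR : R.embedding.IsPlane)
    (hn : 3 ≤ Nat.card V) (d : G.Dart) :
    R.embedding.facePerm (R.embedding.facePerm (R.embedding.facePerm d)) = d := by
  have := G.finite_dart
  have hc : G.Connected := (SimpleGraph.connected_iff _).2 ⟨hG.preconnected R hR, ⟨d.fst⟩⟩
  exact hR.facePerm_pow_three R.isSimple_embedding (by rwa [R.graph_embedding])
    (R.isolated_embedding hc (by omega)) hn (hG.cofacialAdj R hR) d

/-! ### Listing the faces of a connected face cover -/

theorem exists_enumeration_of_connected {α : Type*} [Finite α] {S : Set α} {r : α → α → Prop}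
    {a : α} (ha : a ∈ S)
    (h : ∀ T ⊆ S, a ∈ T → T ≠ S → ∃ x ∈ S, x ∉ T ∧ ∃ t ∈ T, r t x) :
    ∃ (m : ℕ) (g : Fin (m + 1) → α), Function.Injective g ∧ Set.range g = S ∧ g 0 = a ∧
      ∀ i, i ≠ 0 → ∃ j < i, r (g j) (g i) := by
  have key : ∀ m : ℕ, m + 1 ≤ S.ncard → ∃ g : Fin (m + 1) → α, Function.Injective g ∧
      Set.range g ⊆ S ∧ g 0 = a ∧ ∀ i, i ≠ 0 → ∃ j < i, r (g j) (g i) := by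
    intro m
    induction m with
    | zero =>
      intro _
      have : Subsingleton (Fin (0 + 1)) := inferInstanceAs (Subsingleton (Fin 1))
      refine ⟨fun _ => a, Function.injective_of_subsingleton _, ?_, rfl, ?_⟩
      · rintro _ ⟨_, rfl⟩
        exact ha
      · exact fun i hi => absurd (Subsingleton.elim i 0) hi
    | succ m ih =>
      intro hm
      obtain ⟨g, hinj, hS, h0, hr⟩ := ih (by omega)
      have hcard : (Set.range g).ncard = m + 1 := by
        rw [← Set.image_univ, Set.ncard_image_of_injective _ hinj, Set.ncard_univ, Nat.card_fin]
      obtain ⟨x, hxS, hxT, -, ⟨j, rfl⟩, hjx⟩ := h _ hS ⟨0, h0⟩ (by rintro e; rw [e] at hcard; omega)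
      refine ⟨Fin.snoc g x, Fin.snoc_injective_of_injective hinj hxT, ?_, ?_, ?_⟩
      · rintro _ ⟨i, rfl⟩
        induction i using Fin.lastCases with
        | last => rwa [Fin.snoc_last]
        | cast i => rw [Fin.snoc_castSucc]; exact hS ⟨i, rfl⟩
      · rw [← Fin.castSucc_zero, Fin.snoc_castSucc, h0]
      · intro i hi
        induction i using Fin.lastCases with
        | last => exact ⟨j.castSucc, Fin.castSucc_lt_last j, by
            rwa [Fin.snoc_last, Fin.snoc_castSucc]⟩
        | cast i =>
          obtain ⟨l, hl, hlr⟩ := hr i (by rintro rfl; exact hi rfl)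
          exact ⟨l.castSucc, Fin.castSucc_lt_castSucc_iff.2 hl, by
            rwa [Fin.snoc_castSucc, Fin.snoc_castSucc]⟩
  have hpos : 0 < S.ncard := (Set.ncard_pos).2 ⟨a, ha⟩
  obtain ⟨g, hinj, hS, h0, hr⟩ := key (S.ncard - 1) (by omega)
  refine ⟨_, g, hinj, Set.eq_of_subset_of_ncard_le hS ?_, h0, hr⟩
  rw [← Set.image_univ, Set.ncard_image_of_injective _ hinj, Set.ncard_univ, Nat.card_fin]
  omega

namespace EmbeddedGraph

open Equiv.Perm

variable {V : Type u} {D : Type w}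

instance [Finite V] [Finite D] (M : EmbeddedGraph V D) : Finite M.Face :=
  inferInstanceAs (Finite (Quotient (SameCycle.setoid M.facePerm) ⊕ {v : V // ∀ d, M.tail d ≠ v}))

/-- Otherwise the faces in `T` together with their vertices are closed under adjacency in the
connected induced graph, so `T` exhausts `S`. -/
theorem IsConnectedFaceCover.exists_inter {M : EmbeddedGraph V D} {S : Set M.Face}
    (hS : M.IsConnectedFaceCover S) {f : M.Face} {T : Set M.Face} (hTS : T ⊆ S) (hf : f ∈ T)
    (hne : T ≠ S) :
    ∃ x ∈ S, x ∉ T ∧ ∃ t ∈ T, (M.boundary t ∩ M.boundary x).Nonempty := by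
  by_contra! hcon
  refine hne (hTS.antisymm fun s hs => ?_)
  let P : V ⊕ M.Face → Prop := Sum.elim (fun v => ∃ t ∈ T, M.Incident v t) (· ∈ T)
  have hstep : ∀ x y, (M.faceVertexGraph.induce {x | ∀ f, x = Sum.inr f → f ∈ S}).Adj x y →
      P x.1 → P y.1 := by
    rintro ⟨x, hx⟩ ⟨y, hy⟩ hadj hP
    rw [SimpleGraph.comap_adj] at hadj
    obtain ⟨-, ⟨v, g, rfl, rfl, hvg⟩ | ⟨v, g, rfl, rfl, hvg⟩⟩ :=
      (SimpleGraph.fromRel_adj _ _ _).1 hadj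
    · obtain ⟨t, ht, hvt⟩ := hP
      by_contra hg
      have := hcon g (hy g rfl) hg t ht
      exact Set.notMem_empty v (this ▸ ⟨hvt, hvg⟩)
    · exact ⟨g, hP, hvg⟩
  have hwalk : ∀ x y, (M.faceVertexGraph.induce {x | ∀ f, x = Sum.inr f → f ∈ S}).Reachable x y →
      P x.1 → P y.1 := by
    rintro x y ⟨p⟩
    induction p with
    | nil => exact id
    | cons h p ih => exact fun hP => ih (hstep _ _ h hP)
  exact hwalk ⟨Sum.inr f, by rintro _ ⟨⟩; exact hTS hf⟩ ⟨Sum.inr s, by rintro _ ⟨⟩; exact hs⟩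
    (hS.2.preconnected _ _) hf

theorem IsConnectedFaceCover.exists_enumeration [Finite V] [Finite D] {M : EmbeddedGraph V D}
    {S : Set M.Face} (hS : M.IsConnectedFaceCover S) {f : M.Face} (hf : f ∈ S) {c : ℕ}
    (hc : ∀ f, (M.boundary f).ncard ≤ c + 1) :
    ∃ (m : ℕ) (g : Fin (m + 1) → M.Face),
      Function.Injective g ∧ Set.range g = S ∧ g 0 = f ∧
        ∀ i, i ≠ 0 → (M.boundary (g i) \ ⋃ j < i, M.boundary (g j)).ncard ≤ c := by
  obtain ⟨m, g, hinj, hrange, h0, hr⟩ := exists_enumeration_of_connected hf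
    (fun T hTS hfT hne => hS.exists_inter hTS hfT hne)
  refine ⟨m, g, hinj, hrange, h0, fun i hi => ?_⟩
  obtain ⟨j, hj, v, hvj, hvi⟩ := hr i hi
  have hsub : M.boundary (g i) \ ⋃ j < i, M.boundary (g j) ⊆ M.boundary (g i) \ {v} := by
    refine Set.sdiff_subset_sdiff_right ?_
    rw [Set.singleton_subset_iff]
    exact Set.mem_biUnion (s := {j | j < i}) hj hvj
  have h1 := Set.ncard_le_ncard hsub
  have h2 := Set.ncard_sdiff_singleton_add_one hvi
  have h3 := hc (g i)
  omega

/-! ### Splits and the outerplane splitting number -/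

theorem facePerm_split (M : EmbeddedGraph V D) {a b : D} (h : M.tail a = M.tail b) :
    (M.split a b h).facePerm = by classical exact Equiv.swap a b * M.facePerm := rfl

/-- A connected plane graph with at least one edge. -/
structure IsConnectedPlane (M : EmbeddedGraph V D) : Prop where
  isPlane : M.IsPlane
  connected : M.graph.Connected
  isolated_eq_empty : M.isolated = ∅

theorem exists_tail_eq {M : EmbeddedGraph V D} (h : M.isolated = ∅) (v : V) :
    ∃ d, M.tail d = v := by
  by_contra! hv
  exact Set.notMem_empty v (h ▸ hv)

/-- One vertex is gained and one face lost. The two copies stay connected because the merged face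
passes through both. -/
theorem IsConnectedPlane.split [Finite V] [Finite D] {M : EmbeddedGraph V D}
    (hM : M.IsConnectedPlane) {a b : D} (h : M.tail a = M.tail b)
    (hab : ¬ M.facePerm.SameCycle a b) : (M.split a b h).IsConnectedPlane := by
  classical
  have hne : a ≠ b := by
    rintro rfl
    exact hab (SameCycle.refl _ _)
  have hns : ¬ (M.splitRot a b).SameCycle b a := by
    exact fun hc => not_sameCycle_swap_mul hne ((M.sameCycle_rot_iff _ _).2 h) (SameCycle.symm hc)
  have hi : (M.split a b h).isolated = ∅ := by
    refine Set.eq_empty_of_forall_notMem fun v hv => ?_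
    cases v with
    | none => exact hv b (if_pos (SameCycle.refl _ _))
    | some v =>
      by_cases hva : M.tail a = v
      · exact hv a ((if_neg hns).trans (congrArg some hva))
      · obtain ⟨d, hd⟩ := exists_tail_eq hM.isolated_eq_empty v
        refine hv d ((if_neg fun hc => hva ?_).trans (congrArg some hd))
        rw [h, M.tail_eq_of_sameCycle_splitRot h hc, hd]
  have hface : (M.split a b h).facePerm = Equiv.swap a b * M.facePerm := by
    rw [facePerm_split]
  have hconn : (M.split a b h).graph.Connected := by
    refine (SimpleGraph.connected_iff _).2 ⟨fun u v => ?_, ⟨none⟩⟩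
    let f : D → (M.split a b h).graph.ConnectedComponent := fun d =>
      (M.split a b h).graph.connectedComponentMk ((M.split a b h).tail d)
    have hrev : ∀ d, f (M.rev d) = f d := fun d =>
      (SimpleGraph.ConnectedComponent.sound ((M.split a b h).reachable_rev d)).symm
    have hrot' : ∀ d, f ((M.split a b h).rot d) = f d := fun d => by
      simp only [f, (M.split a b h).tail_rot]
    have hfab : f a = f b := by
      refine SimpleGraph.ConnectedComponent.sound
        ((M.split a b h).reachable_of_sameCycle_facePerm ?_)
      rw [hface]
      exact sameCycle_swap_mul hab
    have hrot : ∀ d, f (M.rot d) = f d := by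
      intro d
      rw [← hrot' d]
      change _ = f (Equiv.swap a b (M.rot d))
      rw [Equiv.swap_apply_def]
      split_ifs with h1 h2
      · rw [h1, hfab]
      · rw [h2, hfab]
      · rfl
    obtain ⟨d, rfl⟩ := exists_tail_eq hi u
    obtain ⟨e, rfl⟩ := exists_tail_eq hi v
    exact SimpleGraph.ConnectedComponent.exact
      (M.eq_of_reachable hrot hrev (hM.connected.preconnected (M.tail d) (M.tail e)) rfl rfl)
  refine ⟨?_, hconn, hi⟩
  have h1 := hM.isPlane
  have h2 := cycleCount_swap_mul_add_one hab
  unfold IsPlane at *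
  rw [card_face] at *
  rw [hi, hconn.card_connectedComponent, Set.ncard_empty, hface, Finite.card_option]
  rw [hM.isolated_eq_empty, hM.connected.card_connectedComponent, Set.ncard_empty] at h1
  omega

/-- Guards against the value zero of `sInf` on the empty set. Each split lowers the number of faces;
if none is possible, all corners at a vertex belong to one face, and by connectedness there is only
one face. -/
theorem IsConnectedPlane.exists_splitsToOuterplane [Finite D] (n : ℕ) :
    ∀ {V : Type u} [Finite V] {M : EmbeddedGraph V D}, M.IsConnectedPlane →
      M.facePerm.cycleCount = n → ∃ k, SplitsToOuterplane k M := by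
  classical
  induction n with
  | zero =>
    intro V _ M hM hn
    obtain ⟨v⟩ := hM.connected.nonempty
    obtain ⟨d, -⟩ := exists_tail_eq hM.isolated_eq_empty v
    have : Nonempty (Quotient (SameCycle.setoid M.facePerm)) := ⟨M.faceOf d⟩
    exact absurd hn Nat.card_pos.ne'
  | succ n ih =>
    intro V _ M hM hn
    by_cases hall : ∀ a b, M.tail a = M.tail b → M.faceOf a = M.faceOf b
    · refine ⟨0, hM.isPlane, ?_⟩
      obtain ⟨v⟩ := hM.connected.nonempty
      obtain ⟨d, -⟩ := exists_tail_eq hM.isolated_eq_empty v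
      refine ⟨Sum.inl (M.faceOf d), fun v => ?_⟩
      obtain ⟨e, he⟩ := exists_tail_eq hM.isolated_eq_empty v
      have hrot : ∀ d, M.faceOf (M.rot d) = M.faceOf d := fun d => hall _ _ (M.tail_rot d)
      exact ⟨e, he, M.eq_of_reachable hrot (fun d => (M.faceOf_rot d).symm.trans (hrot d))
        (hM.connected.preconnected _ _) rfl rfl⟩
    · push Not at hall
      obtain ⟨a, b, h, hab⟩ := hall
      have hab' : ¬ M.facePerm.SameCycle a b := fun hc => hab (Quotient.sound hc)
      obtain ⟨k, hk⟩ := ih (hM.split h hab') (by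
        have := cycleCount_swap_mul_add_one hab'
        rw [facePerm_split]
        omega)
      exact ⟨k + 1, a, b, h, hab', hk⟩

/-- The set `s` represents the faces of `M` that cover the final outer face; undoing a split costs
at most one more representative. The darts of the outer face reach every final vertex, so there are
at least |V| + k of them. The first alternative is the face of an isolated vertex. -/
theorem SplitsToOuterplane.exists_finset [Finite D] (k : ℕ) :
    ∀ {V : Type u} [Finite V] {M : EmbeddedGraph V D}, SplitsToOuterplane k M →
      Nat.card V + k ≤ 1 ∨ ∃ s : Finset D, s.card ≤ k + 1 ∧
        Nat.card V + k ≤ {x | ∃ d ∈ s, M.facePerm.SameCycle d x}.ncard := by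
  classical
  induction k with
  | zero =>
    rintro V _ M ⟨-, f | x, hf⟩
    · right
      induction f using Quotient.inductionOn with | _ d
      refine ⟨{d}, by simp, ?_⟩
      rw [add_zero, ← Set.ncard_univ]
      refine (Set.ncard_le_ncard ?_).trans
        (Set.ncard_image_le (f := M.tail)
          (Set.toFinite {x | ∃ e ∈ ({d} : Finset D), M.facePerm.SameCycle e x}))
      intro v _
      obtain ⟨e, he, hed⟩ := hf v
      exact ⟨e, ⟨d, Finset.mem_singleton_self d, SameCycle.symm (Quotient.exact hed)⟩, he⟩
    · left
      have : Subsingleton V := ⟨fun u v => (hf u).symm.trans (hf v)⟩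
      exact Finite.card_le_one_iff_subsingleton.2 this
  | succ k ih =>
    rintro V _ M ⟨a, b, h, hab, hk⟩
    rcases ih hk with h1 | ⟨s, hs, hcard⟩
    · left
      rw [Finite.card_option] at h1
      omega
    right
    rw [Finite.card_option, add_right_comm, add_assoc] at hcard
    -- If `s` meets the merged face, it already represents the part of `a` or that of `b`, so one
    -- new dart suffices for the other.
    obtain ⟨t, hst, ht, hta, htb⟩ : ∃ t, s ⊆ t ∧ t.card ≤ s.card + 1 ∧
        ((∃ d ∈ s, M.facePerm.SameCycle a d ∨ M.facePerm.SameCycle b d) →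
          ∃ d ∈ t, M.facePerm.SameCycle d a) ∧
        ((∃ d ∈ s, M.facePerm.SameCycle a d ∨ M.facePerm.SameCycle b d) →
          ∃ d ∈ t, M.facePerm.SameCycle d b) := by
      by_cases h1 : ∃ d ∈ s, M.facePerm.SameCycle a d
      · obtain ⟨d, hd, hda⟩ := h1
        exact ⟨insert b s, Finset.subset_insert _ _, Finset.card_insert_le _ _,
          fun _ => ⟨d, Finset.mem_insert_of_mem hd, hda.symm⟩,
          fun _ => ⟨b, Finset.mem_insert_self _ _, SameCycle.refl _ _⟩⟩
      · refine ⟨insert a s, Finset.subset_insert _ _, Finset.card_insert_le _ _,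
          fun _ => ⟨a, Finset.mem_insert_self _ _, SameCycle.refl _ _⟩, ?_⟩
        rintro ⟨d, hd, hda | hdb⟩
        · exact absurd ⟨d, hd, hda⟩ h1
        · exact ⟨d, Finset.mem_insert_of_mem hd, hdb.symm⟩
    refine ⟨t, by omega, hcard.trans (Set.ncard_le_ncard ?_)⟩
    rintro x ⟨d, hd, hdx⟩
    rw [facePerm_split] at hdx
    rcases hdx.of_swap_mul with hdx | ⟨hd', hx | hx⟩
    · exact ⟨d, hst hd, hdx⟩
    · obtain ⟨e, he, hea⟩ := hta ⟨d, hd, hd'⟩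
      exact ⟨e, he, hea.trans hx⟩
    · obtain ⟨e, he, heb⟩ := htb ⟨d, hd, hd'⟩
      exact ⟨e, he, heb.trans hx⟩

theorem SplitsToOuterplane.card_le [Finite V] [Finite D] {M : EmbeddedGraph V D}
    (h3 : ∀ d, M.facePerm (M.facePerm (M.facePerm d)) = d) {k : ℕ}
    (hk : SplitsToOuterplane k M) : Nat.card V ≤ 2 * k + 3 := by
  classical
  rcases SplitsToOuterplane.exists_finset k hk with h | ⟨s, hs, hcard⟩
  · omega
  have hsub : {x | ∃ d ∈ s, M.facePerm.SameCycle d x} ⊆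
      ((s.biUnion fun d => {d, M.facePerm d, M.facePerm (M.facePerm d)} : Finset D) : Set D) := by
    rintro x ⟨d, hd, hdx⟩
    simp only [Finset.coe_biUnion, Set.mem_iUnion]
    exact ⟨d, hd, by simpa using sameCycle_facePerm_of_pow_three h3 hdx⟩
  have h1 := Set.ncard_le_ncard hsub
  rw [Set.ncard_coe_finset] at h1
  have h2 := Finset.card_biUnion_le_card_mul s
    (fun d => {d, M.facePerm d, M.facePerm (M.facePerm d)}) 3 (fun d _ => Finset.card_le_three)
  omega

theorem ncard_boundary_le_three {M : EmbeddedGraph V D}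
    (h3 : ∀ d, M.facePerm (M.facePerm (M.facePerm d)) = d) (f : M.Face) :
    (M.boundary f).ncard ≤ 3 := by
  classical
  rcases f with f | x
  · induction f using Quotient.inductionOn with | _ d
    have hsub : M.boundary (Sum.inl (M.faceOf d)) ⊆
        (({M.tail d, M.tail (M.facePerm d), M.tail (M.facePerm (M.facePerm d))} : Finset V) :
          Set V) := by
      rintro _ ⟨e, rfl, he⟩
      rcases sameCycle_facePerm_of_pow_three h3 (SameCycle.symm (Quotient.exact he)) with
        rfl | rfl | rfl <;> simp
    refine (Set.ncard_le_ncard hsub (Finset.finite_toSet _)).trans ?_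
    rw [Set.ncard_coe_finset]
    exact Finset.card_le_three
  · have : M.boundary (Sum.inr x) = {x.1} := by
      ext v
      exact eq_comm
    rw [this, Set.ncard_singleton]
    omega

end EmbeddedGraph

theorem mainTheorem6 {V : Type u} [Finite V] (G : SimpleGraph V) (hG : IsMaximalPlanar G)
    (R : RotationSystem G) (hR : R.embedding.IsPlane) :
    ((Nat.card V : ℝ) - 3) / 2 ≤ (R.embedding.osn : ℝ) ∧
      ∀ S : Set R.embedding.Face, R.embedding.IsConnectedFaceCover S → ∀ f ∈ S,
        ∃ (m : ℕ) (g : Fin (m + 1) → R.embedding.Face),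
          Function.Injective g ∧ Set.range g = S ∧ g 0 = f ∧
            ∀ i, i ≠ 0 →
              (R.embedding.boundary (g i) \ ⋃ j < i, R.embedding.boundary (g j)).ncard ≤ 2 := by
  have := G.finite_dart
  constructor
  -- For at most three vertices the lower bound is not positive.
  · rcases Nat.lt_or_ge 3 (Nat.card V) with hn | hn
    · have h3 := hG.facePerm_pow_three R hR hn.le
      have hc : G.Connected :=
        (SimpleGraph.connected_iff _).2 ⟨hG.preconnected R hR, (Nat.card_pos_iff.1 (by omega)).1⟩
      have hM : R.embedding.IsConnectedPlane :=
        ⟨hR, by rwa [R.graph_embedding], R.isolated_embedding hc (by omega)⟩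
      have hmem : EmbeddedGraph.SplitsToOuterplane R.embedding.osn R.embedding :=
        Nat.sInf_mem (hM.exists_splitsToOuterplane _ rfl)
      have hle : (Nat.card V : ℝ) ≤ 2 * R.embedding.osn + 3 := by exact_mod_cast hmem.card_le h3
      linarith
    · have h1 : (Nat.card V : ℝ) ≤ 3 := by exact_mod_cast hn
      have h2 : (0 : ℝ) ≤ R.embedding.osn := Nat.cast_nonneg _
      linarith
  · intro S hS f hf
    refine hS.exists_enumeration hf fun f => ?_
    rcases Nat.lt_or_ge 3 (Nat.card V) with hn | hn
    · exact EmbeddedGraph.ncard_boundary_le_three (hG.facePerm_pow_three R hR hn.le) f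
    · rw [← Set.ncard_univ] at hn
      exact (Set.ncard_le_ncard (Set.subset_univ _)).trans hn
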